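/- Let $K$ be a number field with ring of integers $\mathcal O_K$, and let $\mathcal A$ be a finite set of (distinct) affine hyperplanes in $K^d$, each given as the zero set $H=V(L_H)$ of a fixed affine linear polynomial $L_H\in\mathcal O_K[X_1,\dots,X_d]$. Let $\mathcal L(\mathcal A)$ be the set of all nonempty intersections of members of $\mathcal A$ (including $\hat 0=K^d$), ordered by reverse inclusion, with Möbius function $\mu$, and let $\widetilde{\mathcal L}(\mathcal A)=\mathcal L(\mathcal A)\setminus\{\hat 0\}$. For $x\in\mathcal L(\mathcal A)$ let $\mathrm{rk}(x)$ be the largest length of a chain from $\hat 0$ to $x$, let $\operatorname{codim}(x)$ be the codimension of $x$ in $K^d$, and put $\mathcal A_x=\{H\in\mathcal A: x\subseteq H\}$ and $\mathcal A^x=\{x\cap H : H\in\mathcal A\setminus\mathcal A_x,\ x\cap H\ne\emptyset\}$ (an arrangement in the affine space $x$); for $x\le y$ put $\mathcal A^x_y=(\mathcal A^x)_y$, and $\mathcal A^x_{\emptyset}=\mathcal A^x$. For an arrangement $\mathcal B$ let $\pi_{\mathcal B}(Y)=\sum_{x\in\mathcal L(\mathcal B)}\mu(\hat 0,x)(-Y)^{\mathrm{rk}(x)}$.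 For a (possibly empty) flag $F=(x_1<\dots<x_\ell)$ in $\widetilde{\mathcal L}(\mathcal A)$ let $\pi_F(Y)=\prod_{k=0}^{\ell}\pi_{\mathcal A^{x_k}_{x_{k+1}}}(Y)$, where $x_0=\hat 0$ and $x_{\ell+1}=\emptyset$. The flag Hilbert–Poincaré series of $\mathcal A$ is $$\mathsf{fHP}_{\mathcal A}\bigl(Y,(T_x)_{x\in\widetilde{\mathcal L}(\mathcal A)}\bigr)=\sum_{F}\pi_F(Y)\prod_{x\in F}\frac{T_x}{1-T_x},$$ the sum being over all flags $F$ in $\widetilde{\mathcal L}(\mathcal A)$. Let $\mathfrak o$ be a compact discrete valuation ring (of any characteristic) that is an $\mathcal O_K$-algebra, with maximal ideal $\mathfrak p$ and residue field of cardinality $q$, and assume that $\mathcal A$ has good reduction: $\mathcal L(\mathcal A)\cong\mathcal L(\mathcal A(\mathfrak o/\mathfrak p))$ as posets, where $\mathcal A(\mathfrak o/\mathfrak p)$ is the arrangement of the hyperplanes in $(\mathfrak o/\mathfrak p)^d$ defined by the reductions of the $L_H$. Let $|\cdot|$ be the absolute value on $\mathfrak o$ with $|\pi|=q^{-1}$ for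 a uniformizer $\pi$, put $\|\mathcal A_x\|=\max\{|L_H| : H\in\mathcal A_x\}$, and for $s=(s_x)\in\mathbb C^{\widetilde{\mathcal L}(\mathcal A)}$ let $$\zeta_{\mathcal A(\mathfrak o)}(s)=\int_{\mathfrak o^d}\prod_{x\in\widetilde{\mathcal L}(\mathcal A)}\|\mathcal A_x\|^{s_x}\,|dX|,$$ where $|dX|$ is the additive Haar measure on $\mathfrak o^d$ of total mass $1$. For $x\in\widetilde{\mathcal L}(\mathcal A)$ put $$g_x(s)=\operatorname{codim}(x)+\sum_{y\in\widetilde{\mathcal L}(\mathcal A_x)}s_y,\qquad h_x(r)=\sum_{y\in\widetilde{\mathcal L}(\mathcal A_x)}(r_y-\operatorname{codim}(y))\,\mu(y,x).$$ (1) If $\operatorname{Re} g_x(s)>0$ for all $x\in\widetilde{\mathcal L}(\mathcal A)$, then the integral $\zeta_{\mathcal A(\mathfrak o)}(s)$ converges absolutely and $$\zeta_{\mathcal A(\mathfrak o)}(s)=\mathsf{fHP}_{\mathcal A}\bigl(-q^{-1},(q^{-g_x(s)})_x\bigr).$$ (2) If $\operatorname{Re} r_x>0$ for all $x\in\widetilde{\mathcal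 L}(\mathcal A)$, then the integral $\zeta_{\mathcal A(\mathfrak o)}((h_x(r))_x)$ converges absolutely and $$\mathsf{fHP}_{\mathcal A}\bigl(-q^{-1},(q^{-r_x})_x\bigr)=\zeta_{\mathcal A(\mathfrak o)}\bigl((h_x(r))_x\bigr).$$ (3) The function $\zeta_{\mathcal A(\mathfrak o)}$ on the nonempty open set of all $s$ in (1) has an analytic continuation to the connected open set of all $s$ with $q^{-g_x(s)}\neq 1$ for all $x$. The continued function satisfies the identity in (1) for all these $s$, and the identity in (2) for all $r$ with $q^{-r_x}\ne1$ for all $x$. (4) Explicitly, for all $s$ as in (1), $$\zeta_{\mathcal A(\mathfrak o)}(s)=\sum_{F}\pi_F(-q^{-1})\prod_{x\in F}\frac{q^{-g_x(s)}}{1-q^{-g_x(s)}},$$ the sum being over all flags $F$ in $\widetilde{\mathcal L}(\mathcal A)$. If $\mathcal A$ is nonempty and central (all its members have a common point), with $\mathrm{rk}(\mathcal A)$ the largest rank of an element of $\mathcal L(\mathcal A)$ and $\hat 1$ the top element of $\mathcal L(\mathcal A)$, then also $$\zeta_{\mathcal A(\mathfrak o)}(s)=\frac{1}{1-q^{-\mathrm{rk}(\mathcal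 A)-\sum_{y\in\widetilde{\mathcal L}(\mathcal A)}s_y}}\sum_{F\not\ni\hat 1}\pi_F(-q^{-1})\prod_{x\in F}\frac{q^{-g_x(s)}}{1-q^{-g_x(s)}},$$ the sum being over all flags $F$ in $\widetilde{\mathcal L}(\mathcal A)\setminus\{\hat 1\}$. -/

import Mathlib

open MeasureTheory IsLocalRing

noncomputable section

/-! ### Hyperplane arrangements and their intersection posets -/

/-- A hyperplane arrangement in a nonempty affine subspace `ambient` of the affine space `V`:
a finite set of affine subspaces of `ambient`, nonempty and of codimension one in `ambient`.
(The ambient space is recorded because restrictions `A^x` are arrangements in the flat `x`.) -/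
structure Arrangement (k V : Type*) [Field k] [AddCommGroup V] [Module k V] where
  ambient : AffineSubspace k V
  ambient_nonempty : (ambient : Set V).Nonempty
  members : Finset (AffineSubspace k V)
  le_ambient : ∀ H ∈ members, H ≤ ambient
  nonempty : ∀ H ∈ members, (H : Set V).Nonempty
  finrank_add_one : ∀ H ∈ members,
    Module.finrank k H.direction + 1 = Module.finrank k ambient.direction

namespace Arrangement

section Basic

variable {k V : Type*} [Field k] [AddCommGroup V] [Module k V]

/-- The flats: nonempty intersections of members; the empty intersection is the ambient space. -/
def IsFlat (A : Arrangement k V) (x : AffineSubspace k V) : Prop :=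
  (x : Set V).Nonempty ∧ ∃ S ⊆ A.members, x = A.ambient ⊓ S.inf id

/-- The intersection poset `𝓛(A)`. -/
def IntPoset (A : Arrangement k V) : Type _ := {x : AffineSubspace k V // A.IsFlat x}

/-- `𝓛(A)` is ordered by reverse inclusion. -/
instance (A : Arrangement k V) : PartialOrder A.IntPoset :=
  PartialOrder.lift (fun x => OrderDual.toDual x.1) fun _ _ h => Subtype.ext h

theorem IntPoset.le_iff {A : Arrangement k V} (x y : A.IntPoset) : x ≤ y ↔ y.1 ≤ x.1 := Iff.rfl

instance (A : Arrangement k V) : Finite A.IntPoset := by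
  classical
  refine Set.Finite.to_subtype (s := {x | A.IsFlat x}) ?_
  refine ((A.members.powerset.image fun S => A.ambient ⊓ S.inf id).finite_toSet).subset ?_
  rintro x ⟨-, S, hS, rfl⟩
  exact Finset.mem_coe.2 (Finset.mem_image_of_mem _ (Finset.mem_powerset.2 hS))

instance (A : Arrangement k V) : Fintype A.IntPoset := Fintype.ofFinite _

instance (A : Arrangement k V) : DecidableEq A.IntPoset := Classical.decEq _

instance (A : Arrangement k V) : LocallyFiniteOrder A.IntPoset := by
  classical exact Fintype.toLocallyFiniteOrder

/-- The bottom element `0̂`, which is the ambient space. -/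
instance (A : Arrangement k V) : OrderBot A.IntPoset where
  bot := ⟨A.ambient, A.ambient_nonempty, ∅, by simp, by simp⟩
  bot_le := by
    rintro ⟨x, hx, S, hS, rfl⟩
    exact (inf_le_left : A.ambient ⊓ S.inf id ≤ A.ambient)

/-- `𝓛(A) ∖ {0̂}`. -/
abbrev Nonbot (A : Arrangement k V) : Type _ := {x : A.IntPoset // x ≠ ⊥}

instance (A : Arrangement k V) : Fintype A.Nonbot := Fintype.ofFinite _

/-- The rank of a flat: the supremum of the lengths of all chains ending in it. -/
def rk (A : Arrangement k V) (x : A.IntPoset) : ℕ := (Order.height x).toNat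

/-- The rank of the arrangement: the largest rank of a flat. -/
def rank (A : Arrangement k V) : ℕ := Finset.univ.sup A.rk

/-- The codimension of a flat in the ambient space. -/
def codim (A : Arrangement k V) (x : A.IntPoset) : ℕ :=
  Module.finrank k A.ambient.direction - Module.finrank k x.1.direction

/-- `A` is central if all its members have a common point. -/
def IsCentral (A : Arrangement k V) : Prop :=
  ((A.ambient ⊓ A.members.inf id : AffineSubspace k V) : Set V).Nonempty

/-- The Möbius function of `𝓛(A)`. -/
def mu (A : Arrangement k V) (x y : A.IntPoset) : ℤ := IncidenceAlgebra.mu ℤ x y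

/-- The Poincaré polynomial `∑ₓ μ(0̂, x) (-Y)^rk(x)`. -/
def poincare (A : Arrangement k V) : Polynomial ℤ :=
  ∑ x : A.IntPoset, Polynomial.C (A.mu ⊥ x) * (-Polynomial.X) ^ A.rk x

open Classical in
/-- The subarrangement `A_x` of all members that contain `x`. -/
def sub (A : Arrangement k V) (x : AffineSubspace k V) : Arrangement k V where
  ambient := A.ambient
  ambient_nonempty := A.ambient_nonempty
  members := A.members.filter fun H => x ≤ H
  le_ambient H hH := A.le_ambient H (Finset.mem_filter.1 hH).1
  nonempty H hH := A.nonempty H (Finset.mem_filter.1 hH).1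
  finrank_add_one H hH := A.finrank_add_one H (Finset.mem_filter.1 hH).1

theorem IntPoset.le_ambient {A : Arrangement k V} (x : A.IntPoset) : x.1 ≤ A.ambient :=
  (bot_le : (⊥ : A.IntPoset) ≤ x)

open Classical in
/-- The restriction `A^x`: the nonempty intersections of `x` with the members not containing `x`,
as an arrangement in `x`. -/
def restrict [FiniteDimensional k V] (A : Arrangement k V) (x : A.IntPoset) :
    Arrangement k V where
  ambient := x.1
  ambient_nonempty := x.2.1
  members := ((A.members.filter fun H => ¬ x.1 ≤ H).image fun H => x.1 ⊓ H).filter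
    fun Z => (Z : Set V).Nonempty
  le_ambient Z hZ := by
    obtain ⟨H, -, rfl⟩ := Finset.mem_image.1 (Finset.mem_filter.1 hZ).1
    exact inf_le_left
  nonempty Z hZ := (Finset.mem_filter.1 hZ).2
  finrank_add_one Z hZ := by
    obtain ⟨hZ, p, hp⟩ := Finset.mem_filter.1 hZ
    obtain ⟨H, hH, rfl⟩ := Finset.mem_image.1 hZ
    obtain ⟨hH, hxH⟩ := Finset.mem_filter.1 hH
    have hpx : p ∈ x.1 := hp.1
    have hpH : p ∈ H := hp.2
    rw [AffineSubspace.direction_inf_of_mem hpx hpH]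
    have hne : ¬ x.1.direction ≤ H.direction := fun h => hxH fun y hy => by
      have := AffineSubspace.vadd_mem_of_mem_direction
        (h (AffineSubspace.vsub_mem_direction hy hpx)) hpH
      simpa using this
    have h1 := Submodule.finrank_sup_add_finrank_inf_eq x.1.direction H.direction
    have h2 : Module.finrank k H.direction <
        Module.finrank k (x.1.direction ⊔ H.direction : Submodule k V) :=
      Submodule.finrank_lt_finrank_of_lt (lt_of_le_of_ne le_sup_right
        fun h => hne (le_sup_left.trans h.ge))
    have h3 : Module.finrank k (x.1.direction ⊔ H.direction : Submodule k V) ≤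
        Module.finrank k A.ambient.direction :=
      Submodule.finrank_mono (sup_le (AffineSubspace.direction_le x.le_ambient)
        (AffineSubspace.direction_le (A.le_ambient H hH)))
    have h4 := A.finrank_add_one H hH
    omega

end Basic

section Flags

variable {k V : Type*} [Field k] [AddCommGroup V] [Module k V]

/-- A (possibly empty) flag `x₁ < ⋯ < x_ℓ` in `𝓛(A) ∖ {0̂}`, that is, a simplex of its order
complex, as a strictly increasing list. -/
def Flag (A : Arrangement k V) : Type _ := {l : List A.Nonbot // l.Pairwise (· < ·)}

instance (A : Arrangement k V) : Finite A.Flag := by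
  classical
  exact Finite.of_injective
    (fun F : A.Flag => (⟨F.1, F.2.imp fun h => h.ne⟩ : {l : List A.Nonbot // l.Nodup}))
    fun F G h => Subtype.ext (Subtype.mk.inj h)

instance (A : Arrangement k V) : Fintype A.Flag := Fintype.ofFinite _

/-- `flagPoincareFrom A x₀ [x₁, …, x_ℓ]` is the product of the Poincaré polynomials of
`(A^{x_k})_{x_{k+1}}`, `0 ≤ k < ℓ`, and of `A^{x_ℓ}`. -/
def flagPoincareFrom [FiniteDimensional k V] (A : Arrangement k V) :
    A.IntPoset → List A.Nonbot → Polynomial ℤ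
  | x, [] => (A.restrict x).poincare
  | x, y :: l => ((A.restrict x).sub y.1.1).poincare * flagPoincareFrom A y.1 l

/-- The flag Poincaré polynomial `π_F`, with `x₀ = 0̂`. -/
def flagPoincare [FiniteDimensional k V] (A : Arrangement k V) (F : A.Flag) : Polynomial ℤ :=
  A.flagPoincareFrom ⊥ F.1

/-- The flag Hilbert–Poincaré series `∑_F π_F(Y) ∏_{x ∈ F} T_x / (1 - T_x)`, for `Y` and `T_x` in
any field `E`; for `E = ℚ(Y, T)` this is the rational function itself, for `E = ℂ` its values. -/
def fHP [FiniteDimensional k V] (A : Arrangement k V) {E : Type*} [Field E]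
    (Y : E) (T : A.Nonbot → E) : E :=
  ∑ F : A.Flag, Polynomial.aeval Y (A.flagPoincare F) *
    (F.1.map fun x => T x / (1 - T x)).prod

open Classical in
/-- `g_x(s) = codim(x) + ∑ s_y`, over `y ∈ 𝓛(A_x) ∖ {0̂}`. -/
def gFun (A : Arrangement k V) (s : A.Nonbot → ℂ) (x : A.Nonbot) : ℂ :=
  A.codim x.1 + ∑ y : A.Nonbot with (A.sub x.1.1).IsFlat y.1.1, s y

open Classical in
/-- `h_x(r) = ∑ (r_y - codim(y)) μ(y, x)`, over `y ∈ 𝓛(A_x) ∖ {0̂}`. -/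
def hFun (A : Arrangement k V) (r : A.Nonbot → ℂ) (x : A.Nonbot) : ℂ :=
  ∑ y : A.Nonbot with (A.sub x.1.1).IsFlat y.1.1, (r y - A.codim y.1) * (A.mu y.1 x.1 : ℂ)

/-- The tuples `s` such that `g_x(s)` has positive real part for all `x`. -/
def convDomain (A : Arrangement k V) : Set (A.Nonbot → ℂ) := {s | ∀ x, 0 < (A.gFun s x).re}

/-- The tuples `s` such that no denominator `1 - q^(-g_x(s))` vanishes. -/
def regularDomain (A : Arrangement k V) (q : ℂ) : Set (A.Nonbot → ℂ) :=
  {s | ∀ x, q ^ (-A.gFun s x) ≠ 1}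

end Flags

end Arrangement

/-! ### Affine linear polynomials and the arrangements they define -/

/-- The affine linear polynomial `const + ∑ⱼ coeff j * Xⱼ` over `R`. -/
structure AffineForm (R : Type*) (d : ℕ) where
  const : R
  coeff : Fin d → R

namespace AffineForm

/-- The value at a point with coordinates in an `R`-algebra. -/
def eval {R S : Type*} [CommRing R] [CommRing S] [Algebra R S] {d : ℕ} (f : AffineForm R d)
    (z : Fin d → S) : S :=
  algebraMap R S f.const + ∑ j, algebraMap R S (f.coeff j) * z j

variable {R : Type*} [CommRing R] {d : ℕ} (k : Type*) [Field k] [Algebra R k]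

/-- The linear part over `k`. -/
def linearPart (f : AffineForm R d) : (Fin d → k) →ₗ[k] k :=
  ∑ j, algebraMap R k (f.coeff j) • LinearMap.proj j

theorem linearPart_apply (f : AffineForm R d) (z : Fin d → k) :
    f.linearPart k z = ∑ j, algebraMap R k (f.coeff j) * z j := by
  simp [linearPart, LinearMap.sum_apply]
  simp only [Algebra.smul_def]

/-- The zero locus `V(f)` in `k^d`. -/
def zeroLocus (f : AffineForm R d) : AffineSubspace k (Fin d → k) where
  carrier := {z | f.eval z = 0}
  smul_vsub_vadd_mem' := by
    intro c p₁ p₂ p₃ h₁ h₂ h₃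
    simp only [Set.mem_ofPred_eq, eval, ← linearPart_apply] at *
    have e : f.linearPart k (c • (p₁ -ᵥ p₂) +ᵥ p₃) =
        c * (f.linearPart k p₁ - f.linearPart k p₂) + f.linearPart k p₃ := by
      simp [vsub_eq_sub, vadd_eq_add]
    rw [e]
    linear_combination c * h₁ - c * h₂ + h₃

/-- `f` has a nonzero linear part over `k`, so that `V(f)` is a hyperplane of `k^d`. -/
def IsNonconstant (f : AffineForm R d) : Prop := ∃ j, algebraMap R k (f.coeff j) ≠ 0

theorem mem_zeroLocus (f : AffineForm R d) (z : Fin d → k) :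
    z ∈ f.zeroLocus k ↔ f.eval z = 0 := Iff.rfl

theorem IsNonconstant.nonempty {f : AffineForm R d} (hf : f.IsNonconstant k) :
    (f.zeroLocus k : Set (Fin d → k)).Nonempty := by
  classical
  obtain ⟨j, hj⟩ := hf
  refine ⟨Pi.single j (-(algebraMap R k f.const) / algebraMap R k (f.coeff j)), ?_⟩
  change f.eval _ = 0
  simp [eval, Pi.single_apply]
  field_simp
  ring

theorem IsNonconstant.finrank {f : AffineForm R d} (hf : f.IsNonconstant k) :
    Module.finrank k (f.zeroLocus k).direction + 1 =
      Module.finrank k (⊤ : AffineSubspace k (Fin d → k)).direction := by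
  classical
  obtain ⟨p, hp⟩ := hf.nonempty
  have hdir : (f.zeroLocus k).direction = LinearMap.ker (f.linearPart k) := by
    ext v
    rw [← AffineSubspace.vadd_mem_iff_mem_direction v hp, mem_zeroLocus, LinearMap.mem_ker]
    have hp' : f.eval p = 0 := hp
    simp only [eval, ← linearPart_apply] at *
    rw [vadd_eq_add, map_add]
    exact ⟨fun h => by linear_combination h - hp', fun h => by linear_combination h + hp'⟩
  obtain ⟨j, hj⟩ := hf
  have hne : f.linearPart k ≠ 0 := by
    intro h
    have := congrArg (fun φ => φ (Pi.single j 1)) h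
    simp [linearPart_apply, Pi.single_apply] at this
    exact hj this
  rw [hdir, AffineSubspace.direction_top, finrank_top,
    Module.Dual.finrank_ker_add_one_of_ne_zero (f := f.linearPart k) hne]

open Classical in
/-- The arrangement in `k^d` of the hyperplanes `V(L i)`; a polynomial `L i` whose linear part
vanishes in `k` defines no hyperplane. -/
def arrangement {ι : Type*} [Fintype ι] (L : ι → AffineForm R d) :
    Arrangement k (Fin d → k) where
  ambient := ⊤
  ambient_nonempty := ⟨0, trivial⟩
  members := (Finset.univ.filter fun i => (L i).IsNonconstant k).image fun i => (L i).zeroLocus k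
  le_ambient _ _ := le_top
  nonempty H hH := by
    obtain ⟨i, hi, rfl⟩ := Finset.mem_image.1 hH
    exact (Finset.mem_filter.1 hi).2.nonempty
  finrank_add_one H hH := by
    obtain ⟨i, hi, rfl⟩ := Finset.mem_image.1 hH
    exact (Finset.mem_filter.1 hi).2.finrank

end AffineForm

/-! ### The analytic zeta function -/

section Zeta

/-- The cardinality `q` of the residue field. -/
def residueCard (𝔬 : Type*) [CommRing 𝔬] [IsLocalRing 𝔬] : ℕ := Nat.card (ResidueField 𝔬)

open Classical in
/-- The normalized absolute value on a discrete valuation ring: `|0| = 0` and `|a| = q^(-v(a))`. -/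
def dvrAbs {𝔬 : Type*} [CommRing 𝔬] [IsDomain 𝔬] [IsDiscreteValuationRing 𝔬] (a : 𝔬) : NNReal :=
  if a = 0 then 0
  else ((residueCard 𝔬 : NNReal)⁻¹) ^ (IsDiscreteValuationRing.addVal 𝔬 a).toNat

/-- The normalized Haar measure on `𝔬^d`: the product of the additive Haar measures of total
mass `1` on the factors. -/
def cubeHaar (𝔬 : Type*) [CommRing 𝔬] [TopologicalSpace 𝔬] [IsTopologicalRing 𝔬] [CompactSpace 𝔬]
    [MeasurableSpace 𝔬] [BorelSpace 𝔬] (d : ℕ) : Measure (Fin d → 𝔬) :=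
  Measure.pi fun _ => Measure.addHaarMeasure (⊤ : TopologicalSpace.PositiveCompacts 𝔬)

variable {R : Type*} [CommRing R] (K : Type*) [Field K] [Algebra R K] {d : ℕ}
  {ι : Type*} [Fintype ι] (L : ι → AffineForm R d)

open Classical in
/-- `‖A_x‖` at the point `z ∈ 𝔬^d`: the maximum of `|L(z)|` over the `L` vanishing on `x`. -/
def normSub {𝔬 : Type*} [CommRing 𝔬] [IsDomain 𝔬] [IsDiscreteValuationRing 𝔬] [Algebra R 𝔬]
    (x : AffineSubspace K (Fin d → K)) (z : Fin d → 𝔬) : NNReal :=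
  (Finset.univ.filter fun i => x ≤ (L i).zeroLocus K).sup fun i => dvrAbs ((L i).eval z)

/-- The integrand `∏ₓ ‖A_x‖^{s_x}` over `x ∈ 𝓛(A) ∖ {0̂}`. -/
def zetaIntegrand {𝔬 : Type*} [CommRing 𝔬] [IsDomain 𝔬] [IsDiscreteValuationRing 𝔬] [Algebra R 𝔬]
    (s : (AffineForm.arrangement K L).Nonbot → ℂ) (z : Fin d → 𝔬) : ℂ :=
  ∏ x, (((normSub K L x.1.1 z : NNReal) : ℝ) : ℂ) ^ s x

/-- The analytic zeta function `∫ ∏ₓ ‖A_x‖^{s_x} |dX|` over `𝔬^d`. -/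
def analyticZeta (𝔬 : Type*) [CommRing 𝔬] [IsDomain 𝔬] [IsDiscreteValuationRing 𝔬] [Algebra R 𝔬]
    [TopologicalSpace 𝔬] [IsTopologicalRing 𝔬] [CompactSpace 𝔬] [MeasurableSpace 𝔬] [BorelSpace 𝔬]
    (s : (AffineForm.arrangement K L).Nonbot → ℂ) : ℂ :=
  ∫ z, zetaIntegrand K L s z ∂(cubeHaar 𝔬 d)

/-- Good reduction: the intersection posets of the arrangement over `K` and of its reduction over
the residue field of `𝔬` are isomorphic. -/
def HasGoodReduction (𝔬 : Type*) [CommRing 𝔬] [IsLocalRing 𝔬] [Algebra R 𝔬] : Prop :=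
  Nonempty ((AffineForm.arrangement K L).IntPoset ≃o
    (AffineForm.arrangement (ResidueField 𝔬) L).IntPoset)

end Zeta

/-- `Z` is the analytic continuation to the connected open set `U` of the function `f`, given on
the nonempty open set `D ⊆ U`. -/
structure IsAnalyticContinuation {E : Type*} [NormedAddCommGroup E] [NormedSpace ℂ E]
    (f : E → ℂ) (D : Set E) (Z : E → ℂ) (U : Set E) : Prop where
  isOpen_left : IsOpen D
  nonempty : D.Nonempty
  isOpen : IsOpen U
  isConnected : IsConnected U
  subset : D ⊆ U
  analytic : AnalyticOnNhd ℂ Z U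
  eqOn : Set.EqOn Z f D

end

/-!
Choose a uniformizer `π` and cut `𝔬 ^ d` into the `q ^ d` residue classes modulo `π`. On the class
of `p` only the flats whose reduction contains `p` contribute to the integrand. They form an
interval `[0̂, x]`, and good reduction provides a point of `x` in the class. Translating to it and
scaling by `π` turns the class into a copy of `𝔬 ^ d` and the integrand into a constant multiple of
the integrand of the arrangement `A_x`. By the finite field method the number of classes belonging
to `x` is a value of the Poincaré polynomial of `A ^ x`, so the integrals of the localizations `A_x`
satisfy a triangular system of linear equations, and the sums over flags satisfy the same system.

Integrability is not needed to set up this recursion: for the truncations of the absolute value of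
the integrand it is a family of inequalities, whose coefficients force finiteness once
`Re g_x(s) > 0`. Good reduction enters only through the number of flats, since reduction
modulo `π` can merge flats of `A` but cannot create new ones.
-/

noncomputable section

section MoebiusInversion

variable {P : Type*} [PartialOrder P] [LocallyFiniteOrder P] [DecidableEq P]

variable [Fintype P] [DecidableLE P]

theorem sum_moebius_filter_le (a b : P) :
    ∑ x : P with x ≤ b, IncidenceAlgebra.mu ℤ a x = if a = b then 1 else 0 := by
  rw [← IncidenceAlgebra.sum_Icc_mu_right]
  refine (Finset.sum_subset (fun x hx => ?_) fun x hxb hx => ?_).symm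
  · exact Finset.mem_filter.2 ⟨Finset.mem_univ x, (Finset.mem_Icc.1 hx).2⟩
  · refine IncidenceAlgebra.apply_eq_zero_of_not_le (fun hax => hx ?_) _
    exact Finset.mem_Icc.2 ⟨hax, (Finset.mem_filter.1 hxb).2⟩

theorem sum_moebius_mul_sum_filter_ge {E : Type*} [Ring E] (f : P → E) (a : P) :
    ∑ x, (IncidenceAlgebra.mu ℤ a x : E) * ∑ y with x ≤ y, f y = f a := by
  calc ∑ x, (IncidenceAlgebra.mu ℤ a x : E) * ∑ y with x ≤ y, f y
      = ∑ y, ((∑ x with x ≤ y, IncidenceAlgebra.mu ℤ a x : ℤ) : E) * f y := by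
        simp only [Finset.mul_sum, Finset.sum_filter, Int.cast_sum, Finset.sum_mul]
        rw [Finset.sum_comm]
        simp only [mul_ite, mul_zero, Int.cast_ite, Int.cast_zero, ite_mul, zero_mul]
    _ = f a := by simp [sum_moebius_filter_le]

end MoebiusInversion

namespace Arrangement

section Flats

variable {k V : Type*} [Field k] [AddCommGroup V] [Module k V] {A : Arrangement k V}

theorem mem_finsetInf_iff {ι : Type*} {S : Finset ι} {f : ι → AffineSubspace k V} {p : V} :
    p ∈ S.inf f ↔ ∀ i ∈ S, p ∈ f i := by
  simp only [Finset.inf_eq_iInf, AffineSubspace.mem_iInf_iff]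

theorem isFlat_iff {w : AffineSubspace k V} :
    A.IsFlat w ↔ (w : Set V).Nonempty ∧ w ≤ A.ambient ∧
      ∀ p ∈ A.ambient, (∀ H ∈ A.members, w ≤ H → p ∈ H) → p ∈ w := by
  classical
  constructor
  · rintro ⟨hne, S, hS, rfl⟩
    refine ⟨hne, inf_le_left, fun p hp h => ⟨hp, mem_finsetInf_iff.2 fun H hH => ?_⟩⟩
    exact h H (hS hH) (inf_le_right.trans (Finset.inf_le hH))
  · rintro ⟨hne, hle, h⟩
    refine ⟨hne, A.members.filter (w ≤ ·), Finset.filter_subset _ _, le_antisymm ?_ fun p hp => ?_⟩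
    · exact le_inf hle (Finset.le_inf fun H hH => (Finset.mem_filter.1 hH).2)
    · exact h p hp.1 fun H hH hwH => mem_finsetInf_iff.1 hp.2 H (Finset.mem_filter.2 ⟨hH, hwH⟩)

theorem mem_members_sub {x H : AffineSubspace k V} :
    H ∈ (A.sub x).members ↔ H ∈ A.members ∧ x ≤ H := by
  classical exact Finset.mem_filter

theorem mem_members_restrict [FiniteDimensional k V] {x : A.IntPoset} {Z : AffineSubspace k V} :
    Z ∈ (A.restrict x).members ↔
      (∃ H ∈ A.members, ¬ x.1 ≤ H ∧ x.1 ⊓ H = Z) ∧ (Z : Set V).Nonempty := by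
  classical
  simp only [restrict, Finset.mem_filter, Finset.mem_image, and_assoc]

theorem isFlat_sub_iff {x : AffineSubspace k V} (hx : x ≤ A.ambient) (w : AffineSubspace k V) :
    (A.sub x).IsFlat w ↔ A.IsFlat w ∧ x ≤ w := by
  simp only [isFlat_iff, mem_members_sub]
  constructor
  · rintro ⟨hne, hle, h⟩
    exact ⟨⟨hne, hle, fun p hp hpH => h p hp fun H hH => hpH H hH.1⟩,
      fun p hp => h p (hx hp) fun H hH _ => hH.2 hp⟩
  · rintro ⟨⟨hne, hle, h⟩, hxw⟩
    exact ⟨hne, hle, fun p hp hpH => h p hp fun H hH hwH => hpH H ⟨hH, hxw.trans hwH⟩ hwH⟩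

theorem isFlat_sub_intPoset_iff (x y : A.IntPoset) : (A.sub x.1).IsFlat y.1 ↔ y ≤ x := by
  rw [isFlat_sub_iff x.le_ambient, and_iff_right y.2, IntPoset.le_iff]

theorem isFlat_restrict_iff [FiniteDimensional k V] (x : A.IntPoset) (w : AffineSubspace k V) :
    (A.restrict x).IsFlat w ↔ A.IsFlat w ∧ w ≤ x.1 := by
  have hx := (isFlat_iff.1 x.2).2.2
  simp only [isFlat_iff, mem_members_restrict]
  constructor
  · rintro ⟨hne, hwx, h⟩
    refine ⟨⟨hne, hwx.trans x.le_ambient, fun p hp hpH => ?_⟩, hwx⟩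
    have hpx : p ∈ x.1 := hx p hp fun H hH hxH => hpH H hH (hwx.trans hxH)
    refine h p hpx ?_
    rintro _ ⟨⟨H, hH, -, rfl⟩, -⟩ hwH
    exact ⟨hpx, hpH H hH (hwH.trans inf_le_right)⟩
  · rintro ⟨⟨hne, -, h⟩, hwx⟩
    refine ⟨hne, hwx, fun p hp hpZ => h p (x.le_ambient hp) fun H hH hwH => ?_⟩
    by_cases hxH : x.1 ≤ H
    · exact hxH hp
    · have hw : w ≤ x.1 ⊓ H := le_inf hwx hwH
      exact (hpZ (x.1 ⊓ H) ⟨⟨H, hH, hxH, rfl⟩, hne.mono hw⟩ hw).2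

theorem isFlat_sub_restrict_iff [FiniteDimensional k V] {x y : A.IntPoset} (hxy : x ≤ y)
    (w : AffineSubspace k V) :
    ((A.restrict x).sub y.1).IsFlat w ↔ A.IsFlat w ∧ w ≤ x.1 ∧ y.1 ≤ w := by
  rw [isFlat_sub_iff (show y.1 ≤ (A.restrict x).ambient from hxy), isFlat_restrict_iff, and_assoc]

theorem IsFlat.inf_member {x H : AffineSubspace k V} (hx : A.IsFlat x) (hH : H ∈ A.members)
    (hne : ((x ⊓ H : AffineSubspace k V) : Set V).Nonempty) : A.IsFlat (x ⊓ H) := by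
  obtain ⟨-, hle, h⟩ := isFlat_iff.1 hx
  exact isFlat_iff.2 ⟨hne, inf_le_left.trans hle, fun p hp hpH =>
    ⟨h p hp fun H' hH' hx' => hpH H' hH' (inf_le_left.trans hx'), hpH H hH inf_le_right⟩⟩

theorem exists_member_of_lt {x y : A.IntPoset} (h : x < y) :
    ∃ H ∈ A.members, y.1 ≤ H ∧ ¬ x.1 ≤ H := by
  by_contra! hall
  exact h.not_ge fun p hp =>
    (isFlat_iff.1 y.2).2.2 p (x.le_ambient hp) fun H hH hyH => hall H hH hyH hp

theorem IsCentral.exists_isTop (hA : A.IsCentral) : ∃ x : A.IntPoset, IsTop x := by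
  refine ⟨⟨A.ambient ⊓ A.members.inf id, hA, A.members, subset_rfl, rfl⟩, ?_⟩
  rintro ⟨_, hy, S, hS, rfl⟩
  exact inf_le_inf_left A.ambient (Finset.inf_mono hS)

theorem sub_eq_self {x : AffineSubspace k V} (h : ∀ H ∈ A.members, x ≤ H) : A.sub x = A := by
  classical
  cases A
  simp only [sub, mk.injEq, true_and]
  exact Finset.filter_true_of_mem h

theorem sub_restrict_of_isTop [FiniteDimensional k V] {t : A.IntPoset} (ht : IsTop t)
    (x : A.IntPoset) : (A.restrict x).sub t.1 = A.restrict x := by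
  refine sub_eq_self fun Z hZ => ?_
  obtain ⟨⟨H, hH, -, rfl⟩, hne⟩ := mem_members_restrict.1 hZ
  exact ht ⟨x.1 ⊓ H, x.2.inf_member hH hne⟩

theorem ne_bot_of_isTop {t : A.IntPoset} (ht : IsTop t) (hA : A.members.Nonempty) : t ≠ ⊥ := by
  rintro rfl
  obtain ⟨H, hH⟩ := hA
  have hflat : A.IsFlat H :=
    isFlat_iff.2 ⟨A.nonempty H hH, A.le_ambient H hH, fun p _ hp => hp H hH le_rfl⟩
  have hle : A.ambient ≤ H := ht ⟨H, hflat⟩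
  have hrank := A.finrank_add_one H hH
  rw [← hle.antisymm (A.le_ambient H hH)] at hrank
  exact Nat.succ_ne_self _ hrank

end Flats

section Rank

variable {k V : Type*} [Field k] [AddCommGroup V] [Module k V] {A : Arrangement k V}

@[simp]
theorem codim_bot (A : Arrangement k V) : A.codim ⊥ = 0 := Nat.sub_self _

theorem poincare_eq_one_of_subsingleton [Subsingleton A.IntPoset] : A.poincare = 1 := by
  have hbot (x : A.IntPoset) : x = ⊥ := Subsingleton.elim _ _
  rw [poincare, Fintype.sum_eq_single ⊥ fun x hx => absurd (hbot x) hx]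
  simp [mu, rk]

variable [FiniteDimensional k V]

theorem poincare_sub_restrict_self (x : A.IntPoset) : ((A.restrict x).sub x.1).poincare = 1 := by
  have hflat (w : ((A.restrict x).sub x.1).IntPoset) : w.1 = x.1 :=
    have ⟨_, hwx, hxw⟩ := (isFlat_sub_restrict_iff le_rfl w.1).1 w.2
    hwx.antisymm hxw
  have : Subsingleton ((A.restrict x).sub x.1).IntPoset :=
    ⟨fun v w => Subtype.ext ((hflat v).trans (hflat w).symm)⟩
  exact poincare_eq_one_of_subsingleton

theorem finrank_direction_add_codim (x : A.IntPoset) :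
    Module.finrank k x.1.direction + A.codim x = Module.finrank k A.ambient.direction :=
  Nat.add_sub_of_le (Submodule.finrank_mono (AffineSubspace.direction_le x.le_ambient))

theorem codim_strictMono (A : Arrangement k V) : StrictMono A.codim := by
  intro x y h
  have hlt : Module.finrank k y.1.direction < Module.finrank k x.1.direction :=
    Submodule.finrank_lt_finrank_of_lt (AffineSubspace.direction_lt_of_nonempty
      (lt_of_le_of_ne h.le fun e => h.ne' (Subtype.ext e)) y.2.1)
  have := finrank_direction_add_codim x
  have := finrank_direction_add_codim y
  omega

theorem codim_of_covBy {x y : A.IntPoset} (h : x ⋖ y) : A.codim y = A.codim x + 1 := by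
  obtain ⟨H, hH, hyH, hxH⟩ := exists_member_of_lt h.lt
  have hyz : y.1 ≤ x.1 ⊓ H := le_inf h.le hyH
  have hne := y.2.1.mono hyz
  let z : A.IntPoset := ⟨x.1 ⊓ H, x.2.inf_member hH hne⟩
  have hxz : x < z := lt_of_le_of_ne (inf_le_left : x.1 ⊓ H ≤ x.1) fun e =>
    hxH (inf_eq_left.1 (congrArg Subtype.val e).symm)
  have hzy : z = y := eq_of_le_of_not_lt hyz (h.2 hxz)
  have hfin : Module.finrank k z.1.direction + 1 = Module.finrank k x.1.direction :=
    (A.restrict x).finrank_add_one z.1 (mem_members_restrict.2 ⟨⟨H, hH, hxH, rfl⟩, hne⟩)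
  have := finrank_direction_add_codim x
  have := finrank_direction_add_codim z
  rw [← hzy]
  omega

theorem height_eq_codim (x : A.IntPoset) : Order.height x = A.codim x := by
  apply le_antisymm
  · simpa using Order.height_le_height_apply_of_strictMono _ A.codim_strictMono x
  induction x using WellFoundedLT.induction with
  | ind x ih =>
    obtain rfl | hx := eq_or_ne x ⊥
    · simp
    · obtain ⟨y, -, hyx⟩ := exists_le_covBy_of_lt (bot_lt_iff_ne_bot.2 hx)
      rw [codim_of_covBy hyx, Nat.cast_succ]
      exact (add_le_add_left (ih y hyx.lt) 1).trans (Order.height_add_one_le hyx.lt)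

theorem rk_eq_codim (x : A.IntPoset) : A.rk x = A.codim x := by
  rw [rk, height_eq_codim, ENat.toNat_natCast]

theorem rank_eq_codim_of_isTop {t : A.IntPoset} (ht : IsTop t) : A.rank = A.codim t := by
  refine le_antisymm (Finset.sup_le fun x _ => ?_) ?_
  · rw [rk_eq_codim]
    exact A.codim_strictMono.monotone (ht x)
  · rw [← rk_eq_codim]
    exact Finset.le_sup (Finset.mem_univ t)

open Classical in
theorem aeval_neg_poincare {E : Type*} [CommRing E] (t : E) (N : A.IntPoset → E)
    (hN : ∀ x, ∑ y with x ≤ y, N y = t ^ A.codim x) :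
    Polynomial.aeval (-t) A.poincare = N ⊥ := by
  rw [← sum_moebius_mul_sum_filter_ge N ⊥]
  simp [poincare, rk_eq_codim, mu, hN]

end Rank

section Exponents

variable {k V : Type*} [Field k] [AddCommGroup V] [Module k V] (A : Arrangement k V)

theorem sum_intPoset_eq_add_sum_nonbot {E : Type*} [AddCommMonoid E] (f : A.IntPoset → E) :
    ∑ x, f x = f ⊥ + ∑ y : A.Nonbot, f y.1 := by
  rw [Fintype.sum_eq_add_sum_compl ⊥, Finset.sum_subtype (p := (· ≠ ⊥)) {⊥}ᶜ fun x => by simp]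

open Classical in
/-- The zeta matrix of `𝓛(A) ∖ {0̂}`, the linear part of `s ↦ (g_x(s))ₓ`. -/
def zetaMatrix : Matrix A.Nonbot A.Nonbot ℂ := .of fun x y => if y ≤ x then 1 else 0

/-- The Möbius matrix of `𝓛(A) ∖ {0̂}`, transposed like `zetaMatrix`. -/
def moebiusMatrix : Matrix A.Nonbot A.Nonbot ℂ := .of fun x y => A.mu y.1 x.1

/-- The codimensions as a vector indexed by `𝓛(A) ∖ {0̂}`. -/
def codimVec (x : A.Nonbot) : ℂ := A.codim x.1

theorem gFun_eq_add_mulVec (s : A.Nonbot → ℂ) :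
    A.gFun s = A.codimVec + A.zetaMatrix.mulVec s := by
  classical
  funext x
  simp [gFun, codimVec, zetaMatrix, Matrix.mulVec, dotProduct, isFlat_sub_intPoset_iff,
    Finset.sum_filter, Subtype.coe_le_coe]

theorem hFun_eq_mulVec (r : A.Nonbot → ℂ) :
    A.hFun r = A.moebiusMatrix.mulVec (r - A.codimVec) := by
  classical
  funext x
  rw [hFun, Finset.sum_filter_of_ne fun y _ hy => (isFlat_sub_intPoset_iff x.1 y.1).2 <|
    IncidenceAlgebra.le_of_ne_zero (Int.cast_ne_zero.1 (right_ne_zero_of_mul hy))]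
  exact Finset.sum_congr rfl fun y _ => mul_comm _ _

theorem zetaMatrix_mul_moebiusMatrix [DecidableEq A.Nonbot] :
    A.zetaMatrix * A.moebiusMatrix = 1 := by
  classical
  ext x z
  have hbot : A.mu z.1 ⊥ = 0 :=
    IncidenceAlgebra.apply_eq_zero_of_not_le (fun h => z.2 (le_bot_iff.1 h)) _
  have hsum : ∑ y : A.Nonbot, (if y ≤ x then A.mu z.1 y.1 else 0) = if z.1 = x.1 then 1 else 0 := by
    rw [← sum_moebius_filter_le, Finset.sum_filter, sum_intPoset_eq_add_sum_nonbot]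
    change _ = (if ⊥ ≤ x.1 then A.mu z.1 ⊥ else 0) + _
    rw [hbot, ite_self, zero_add]
    rfl
  simpa [Matrix.mul_apply, Matrix.one_apply, zetaMatrix, moebiusMatrix, Subtype.coe_inj,
    eq_comm] using congrArg (Int.cast (R := ℂ)) hsum

theorem gFun_hFun (r : A.Nonbot → ℂ) : A.gFun (A.hFun r) = r := by
  classical
  rw [hFun_eq_mulVec, gFun_eq_add_mulVec, Matrix.mulVec_mulVec, zetaMatrix_mul_moebiusMatrix,
    Matrix.one_mulVec, add_sub_cancel]

theorem hFun_gFun (s : A.Nonbot → ℂ) : A.hFun (A.gFun s) = s := by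
  classical
  rw [hFun_eq_mulVec, gFun_eq_add_mulVec, add_sub_cancel_left, Matrix.mulVec_mulVec,
    mul_eq_one_comm.1 A.zetaMatrix_mul_moebiusMatrix, Matrix.one_mulVec]

theorem gFun_of_isTop [FiniteDimensional k V] {t : A.Nonbot} (ht : IsTop t.1)
    (s : A.Nonbot → ℂ) : A.gFun s t = A.rank + ∑ y, s y := by
  classical
  rw [gFun, rank_eq_codim_of_isTop ht,
    Finset.filter_true_of_mem fun y _ => (isFlat_sub_intPoset_iff t.1 y.1).2 (ht y.1)]

end Exponents

section FlagSums

variable {k V : Type*} [Field k] [AddCommGroup V] [Module k V] (A : Arrangement k V)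

/-- The flags all of whose members lie strictly above `x`. -/
abbrev FlagAbove (x : A.IntPoset) : Type _ := {F : A.Flag // ∀ y ∈ F.1, x < y.1}

/-- A nonempty flag above `x` is its least member `y` followed by a flag above `y`. -/
def flagAboveEquiv (x : A.IntPoset) :
    A.FlagAbove x ≃ Option (Σ y : {y : A.Nonbot // x < y.1}, A.FlagAbove y.1.1) where
  toFun
    | ⟨⟨[], _⟩, _⟩ => none
    | ⟨⟨y :: l, hF⟩, hx⟩ => some ⟨⟨y, hx y List.mem_cons_self⟩,
        ⟨l, (List.pairwise_cons.1 hF).2⟩, (List.pairwise_cons.1 hF).1⟩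
  invFun
    | none => ⟨⟨[], List.Pairwise.nil⟩, by simp⟩
    | some ⟨y, F⟩ => ⟨⟨y.1 :: F.1.1, List.pairwise_cons.2 ⟨F.2, F.1.2⟩⟩,
        List.forall_mem_cons.2 ⟨y.2, fun z hz => y.2.trans (F.2 z hz)⟩⟩
  left_inv := by rintro ⟨⟨_ | _, _⟩, _⟩ <;> rfl
  right_inv := by rintro (_ | _) <;> rfl

instance (x : A.IntPoset) : Fintype (A.FlagAbove x) := Fintype.ofFinite _

variable [FiniteDimensional k V] {E : Type*}

/-- The sum over the flags `x < x₁ < ⋯ < x_ℓ` of the products of the Poincaré polynomials of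
`(A^{x_k})_{x_{k+1}}`, `x₀ = x`, at `Y`, weighted by `τ`. -/
def flagSum [CommRing E] (Y : E) (τ : A.Nonbot → E) (x : A.IntPoset) : E :=
  ∑ F : A.FlagAbove x, Polynomial.aeval Y (A.flagPoincareFrom x F.1.1) * (F.1.1.map τ).prod

theorem sum_flag_eq_flagSum [CommRing E] (Y : E) (τ : A.Nonbot → E) :
    ∑ F : A.Flag, Polynomial.aeval Y (A.flagPoincare F) * (F.1.map τ).prod = A.flagSum Y τ ⊥ := by
  refine Fintype.sum_equiv (Equiv.subtypeUnivEquiv fun F y _ => ?_).symm _ _ fun F => rfl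
  exact bot_lt_iff_ne_bot.2 y.2

open Classical in
theorem flagSum_eq_add_sum [CommRing E] (Y : E) (τ : A.Nonbot → E) (x : A.IntPoset) :
    A.flagSum Y τ x = Polynomial.aeval Y (A.restrict x).poincare +
      ∑ y : A.Nonbot with x < y.1, Polynomial.aeval Y ((A.restrict x).sub y.1.1).poincare *
        (τ y * A.flagSum Y τ y.1) := by
  rw [flagSum, ← (A.flagAboveEquiv x).symm.sum_comp, Fintype.sum_option, Fintype.sum_sigma,
    Finset.sum_filter, ← Finset.sum_filter, ← Finset.sum_subtype_eq_sum_filter]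
  congr 1
  · simp [flagAboveEquiv, flagPoincareFrom]
  · rw [Finset.subtype_univ]
    refine Finset.sum_congr rfl fun y _ => ?_
    rw [flagSum, Finset.mul_sum, Finset.mul_sum]
    refine Finset.sum_congr rfl fun F _ => ?_
    simp only [flagAboveEquiv, Equiv.coe_fn_symm_mk, flagPoincareFrom, map_mul, List.map_cons,
      List.prod_cons]
    ring

open Classical in
theorem sum_aeval_poincare_mul_eq_flagSum [CommRing E] {Y : E} {τ : A.Nonbot → E}
    {W : A.IntPoset → E} (hbot : W ⊥ = 1)
    (hW : ∀ y : A.Nonbot, W y.1 = τ y * ∑ x with x < y.1,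
      Polynomial.aeval Y ((A.restrict x).sub y.1.1).poincare * W x) :
    ∑ x, Polynomial.aeval Y (A.restrict x).poincare * W x = A.flagSum Y τ ⊥ := by
  let S := A.flagSum Y τ
  let P (x : A.IntPoset) (y : A.Nonbot) := Polynomial.aeval Y ((A.restrict x).sub y.1.1).poincare
  have hsplit : ∑ x, S x * W x = S ⊥ + ∑ y : A.Nonbot, S y.1 * W y.1 := by
    rw [sum_intPoset_eq_add_sum_nonbot, hbot, mul_one]
  have hswap : ∑ x, (∑ y : A.Nonbot with x < y.1, P x y * (τ y * S y.1)) * W x =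
      ∑ y : A.Nonbot, S y.1 * W y.1 := by
    simp only [hW, Finset.sum_filter, Finset.sum_mul, Finset.mul_sum]
    rw [Finset.sum_comm]
    refine Finset.sum_congr rfl fun y _ => Finset.sum_congr rfl fun x _ => ?_
    split_ifs
    · ring
    · simp
  calc ∑ x, Polynomial.aeval Y (A.restrict x).poincare * W x
      = ∑ x, (S x - ∑ y : A.Nonbot with x < y.1, P x y * (τ y * S y.1)) * W x :=
        Finset.sum_congr rfl fun x _ =>
          congrArg (· * W x) (eq_sub_of_add_eq (A.flagSum_eq_add_sum Y τ x).symm)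
    _ = A.flagSum Y τ ⊥ := by
        simp only [sub_mul, Finset.sum_sub_distrib]
        rw [hswap, hsplit, add_sub_cancel_right]

theorem flagSum_of_isTop [CommRing E] (Y : E) (τ : A.Nonbot → E) {t : A.IntPoset}
    (ht : IsTop t) : A.flagSum Y τ t = 1 := by
  classical
  have : Subsingleton (A.restrict t).IntPoset := by
    refine ⟨fun z w => Subtype.ext ?_⟩
    have h (z : (A.restrict t).IntPoset) : z.1 = t.1 :=
      le_antisymm z.le_ambient (ht ⟨z.1, ((isFlat_restrict_iff t z.1).1 z.2).1⟩)
    rw [h, h]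
  rw [flagSum_eq_add_sum, poincare_eq_one_of_subsingleton, map_one,
    Finset.filter_false_of_mem fun y _ => (ht y.1).not_gt, Finset.sum_empty, add_zero]

theorem flagSum_eq_one_add_mul [CommRing E] [DecidableEq A.Nonbot] (Y : E) (τ : A.Nonbot → E)
    {t : A.Nonbot} (ht : IsTop t.1) {x : A.IntPoset} (hx : x ≠ t.1) :
    A.flagSum Y τ x = (1 + τ t) * A.flagSum Y (Function.update τ t 0) x := by
  classical
  induction x using WellFoundedGT.induction with
  | ind x ih =>
    have hmem : t ∈ Finset.univ.filter fun y : A.Nonbot => x < y.1 :=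
      Finset.mem_filter.2 ⟨Finset.mem_univ t, lt_of_le_of_ne (ht x) hx⟩
    rw [flagSum_eq_add_sum, flagSum_eq_add_sum, ← Finset.add_sum_erase _ _ hmem,
      ← Finset.add_sum_erase _ _ hmem, Function.update_self, flagSum_of_isTop A Y τ ht,
      sub_restrict_of_isTop ht, mul_one, zero_mul, mul_zero, zero_add, mul_add, Finset.mul_sum,
      ← add_assoc]
    refine congrArg₂ (· + ·) (by ring) (Finset.sum_congr rfl fun y hy => ?_)
    obtain ⟨hyt, hy⟩ := Finset.mem_erase.1 hy
    rw [ih y.1 (Finset.mem_filter.1 hy).2 (Subtype.coe_ne_coe.2 hyt), Function.update_of_ne hyt]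
    ring

open Classical in
theorem flagSum_update_zero_of_isTop [CommRing E] (Y : E) (τ : A.Nonbot → E) {t : A.Nonbot}
    (ht : IsTop t.1) :
    A.flagSum Y (Function.update τ t 0) ⊥ = ∑ F : A.Flag with ∀ x ∈ F.1, ¬ IsTop x.1,
      Polynomial.aeval Y (A.flagPoincare F) * (F.1.map τ).prod := by
  have htop (y : A.Nonbot) : IsTop y.1 ↔ y = t :=
    ⟨fun hy => Subtype.ext (hy.isMax.eq_of_le (ht y.1)), fun h => h ▸ ht⟩
  rw [← sum_flag_eq_flagSum, Finset.sum_filter]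
  refine Finset.sum_congr rfl fun F _ => ?_
  split_ifs with hF
  · congr 2
    exact List.map_congr_left fun y hy =>
      Function.update_of_ne (mt (htop y).2 (hF y hy)) _ _
  · push Not at hF
    obtain ⟨y, hy, hyt⟩ := hF
    rw [List.prod_eq_zero, mul_zero]
    exact List.mem_map.2 ⟨y, hy, by rw [(htop y).1 hyt, Function.update_self]⟩

theorem fHP_eq_flagSum [Field E] (Y : E) (T : A.Nonbot → E) :
    A.fHP Y T = A.flagSum Y (fun x => T x / (1 - T x)) ⊥ :=
  A.sum_flag_eq_flagSum Y _

open Classical in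
theorem fHP_eq_of_isTop [Field E] (Y : E) {T : A.Nonbot → E} {t : A.Nonbot} (ht : IsTop t.1)
    (hT : T t ≠ 1) :
    A.fHP Y T = 1 / (1 - T t) * ∑ F : A.Flag with ∀ x ∈ F.1, ¬ IsTop x.1,
      Polynomial.aeval Y (A.flagPoincare F) * (F.1.map fun x => T x / (1 - T x)).prod := by
  have hone : 1 + T t / (1 - T t) = 1 / (1 - T t) := by
    have := sub_ne_zero.2 hT.symm
    field_simp
    ring
  rw [fHP_eq_flagSum, flagSum_eq_one_add_mul A Y _ ht t.2.symm, hone,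
    flagSum_update_zero_of_isTop A Y _ ht]

end FlagSums

end Arrangement

section Minors

open Matrix

variable {m n F : Type*} [Fintype m] [DecidableEq m] [Finite n] [Field F]

theorem exists_det_submatrix_ne_zero {M : Matrix m n F} (hM : LinearIndependent F M.row) :
    ∃ f : m → n, (M.submatrix id f).det ≠ 0 := by
  have := Fintype.ofFinite n
  obtain ⟨κ, a, -, hspan, hindep⟩ := exists_linearIndependent' F M.col
  have htop : Submodule.span F (Set.range (M.col ∘ a)) = ⊤ := by
    refine Submodule.eq_top_of_finrank_eq ?_
    rw [hspan, ← Matrix.rank_eq_finrank_span_cols, hM.rank_matrix,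
      Module.finrank_fintype_fun_eq_card]
  let e := (Pi.basisFun F m).indexEquiv (Module.Basis.mk hindep htop.ge)
  refine ⟨a ∘ e, ((Matrix.isUnit_iff_isUnit_det _).1 ?_).ne_zero⟩
  rw [← Matrix.linearIndependent_cols_iff_isUnit]
  exact hindep.comp e e.injective

end Minors

namespace AffineForm

open Matrix

section Ring

variable {R : Type*} [CommRing R] {d : ℕ} {ι : Type*} {S : Type*} [CommRing S] [Algebra R S]
  {L : ι → AffineForm R d} {B : Finset ι}

theorem map_eval {T : Type*} [CommRing T] [Algebra R T] (φ : S →ₐ[R] T) (f : AffineForm R d)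
    (z : Fin d → S) : φ (f.eval z) = f.eval fun j => φ (z j) := by
  simp [eval]

theorem residue_eval {𝔬 : Type*} [CommRing 𝔬] [IsLocalRing 𝔬] [Algebra R 𝔬] (f : AffineForm R d)
    (z : Fin d → 𝔬) : residue 𝔬 (f.eval z) = f.eval fun j => residue 𝔬 (z j) :=
  map_eval (IsScalarTower.toAlgHom R 𝔬 (ResidueField 𝔬)) f z

theorem eval_sub (f : AffineForm R d) (v w : Fin d → S) :
    f.eval (v - w) = f.eval v - (fun j => algebraMap R S (f.coeff j)) ⬝ᵥ w := by
  simp only [eval, dotProduct, Pi.sub_apply, mul_sub, Finset.sum_sub_distrib]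
  ring

theorem eval_add (f : AffineForm R d) (v w : Fin d → S) :
    f.eval (v + w) = f.eval v + (fun j => algebraMap R S (f.coeff j)) ⬝ᵥ w := by
  simp only [eval, dotProduct, Pi.add_apply, mul_add, Finset.sum_add_distrib, add_assoc]

theorem mul_eval_eq_sum_of_forall {f : AffineForm R d} {a : R} {c : B → R}
    (h : ∀ z : Fin d → R, a * f.eval z = ∑ b, c b * (L b).eval z) (z : Fin d → S) :
    algebraMap R S a * f.eval z = ∑ b, algebraMap R S (c b) * (L b).eval z := by
  have hconst : a * f.const = ∑ b, c b * (L b).const := by simpa [eval] using h 0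
  have hcoeff (j : Fin d) : a * f.coeff j = ∑ b, c b * (L b).coeff j := by
    have := h (Pi.single j 1)
    simpa [eval, Pi.single_apply, mul_add, Finset.sum_add_distrib, hconst] using this
  calc algebraMap R S a * f.eval z
      = algebraMap R S (a * f.const) + ∑ j, algebraMap R S (a * f.coeff j) * z j := by
        simp only [eval, map_mul, mul_add, Finset.mul_sum, mul_assoc]
    _ = _ := by
        simp only [hconst, hcoeff, eval, map_sum, map_mul, mul_add, Finset.mul_sum,
          Finset.sum_mul, Finset.sum_add_distrib, mul_assoc]
        rw [Finset.sum_comm]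

variable (S L B) in
/-- The coefficient matrix over `S` of the linear parts of the forms indexed by `B`. -/
def coeffMatrix : Matrix B (Fin d) S := .of fun b j => algebraMap R S ((L b).coeff j)

variable [DecidableEq ι]

theorem eval_sub_mulVec_eval {N : Matrix (Fin d) B S} (hN : coeffMatrix S L B * N = 1)
    (v : Fin d → S) (b : B) : (L b).eval (v - N *ᵥ fun b : B => (L b).eval v) = 0 := by
  rw [eval_sub, sub_eq_zero]
  have h : coeffMatrix S L B *ᵥ (N *ᵥ fun b : B => (L b).eval v) = fun b : B => (L b).eval v := by
    rw [mulVec_mulVec, hN, one_mulVec]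
  exact (congrFun h b).symm

theorem algebraMap_det_submatrix_coeffMatrix (f : B → Fin d) :
    algebraMap R S ((coeffMatrix R L B).submatrix id f).det =
      ((coeffMatrix S L B).submatrix id f).det :=
  RingHom.map_det _ _

theorem exists_coeffMatrix_mul_eq_one {f : B → Fin d}
    (hf : IsUnit (algebraMap R S ((coeffMatrix R L B).submatrix id f).det)) :
    ∃ N : Matrix (Fin d) B S, coeffMatrix S L B * N = 1 := by
  rw [algebraMap_det_submatrix_coeffMatrix] at hf
  refine ⟨(1 : Matrix (Fin d) (Fin d) S).submatrix id f *
    ((coeffMatrix S L B).submatrix id f)⁻¹, ?_⟩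
  have hcols : coeffMatrix S L B * (1 : Matrix (Fin d) (Fin d) S).submatrix id f =
      (coeffMatrix S L B).submatrix id f := by
    ext b b'
    simp [mul_apply, one_apply]
  rw [← Matrix.mul_assoc, hcols, mul_nonsing_inv _ hf]

end Ring

section Field

variable {R : Type*} [CommRing R] {d : ℕ} {ι : Type*} (F : Type*) [Field F] [Algebra R F]
  (L : ι → AffineForm R d) (B : Finset ι)

/-- The common zero set of the forms indexed by `B`. -/
def zeroSet : AffineSubspace F (Fin d → F) := B.inf fun i => (L i).zeroLocus F

/-- The linear parts of the forms indexed by `B` are linearly independent over `F`. -/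
def IsIndep : Prop := LinearIndependent F (coeffMatrix F L B).row

variable {F L B}

theorem mem_zeroSet {z : Fin d → F} : z ∈ zeroSet F L B ↔ ∀ i ∈ B, (L i).eval z = 0 :=
  Arrangement.mem_finsetInf_iff

theorem le_zeroSet_iff {x : AffineSubspace F (Fin d → F)} :
    x ≤ zeroSet F L B ↔ ∀ i ∈ B, x ≤ (L i).zeroLocus F := Finset.le_inf_iff

theorem zeroSet_anti {B' : Finset ι} (h : B ⊆ B') : zeroSet F L B' ≤ zeroSet F L B :=
  Finset.inf_mono h

theorem isIndep_iff_exists_minor [DecidableEq ι] :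
    IsIndep F L B ↔
      ∃ f : B → Fin d, algebraMap R F ((coeffMatrix R L B).submatrix id f).det ≠ 0 := by
  simp only [algebraMap_det_submatrix_coeffMatrix]
  refine ⟨exists_det_submatrix_ne_zero, fun ⟨f, hf⟩ => ?_⟩
  have hrow := linearIndependent_rows_iff_isUnit.2
    ((isUnit_iff_isUnit_det _).2 (isUnit_iff_ne_zero.2 hf))
  exact LinearIndependent.of_comp (LinearMap.funLeft F F f) hrow

theorem IsIndep.exists_coeffMatrix_mul_eq_one [DecidableEq ι] (h : IsIndep F L B) :
    ∃ N : Matrix (Fin d) B F, coeffMatrix F L B * N = 1 := by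
  obtain ⟨f, hf⟩ := isIndep_iff_exists_minor.1 h
  exact AffineForm.exists_coeffMatrix_mul_eq_one hf.isUnit

theorem IsIndep.nonempty_zeroSet (h : IsIndep F L B) :
    (zeroSet F L B : Set (Fin d → F)).Nonempty := by
  classical
  obtain ⟨N, hN⟩ := h.exists_coeffMatrix_mul_eq_one
  exact ⟨_, mem_zeroSet.2 fun i hi => eval_sub_mulVec_eval hN 0 ⟨i, hi⟩⟩

theorem vadd_mem_zeroSet_iff {p v : Fin d → F} (hp : p ∈ zeroSet F L B) :
    v + p ∈ zeroSet F L B ↔ coeffMatrix F L B *ᵥ v = 0 := by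
  rw [mem_zeroSet] at hp ⊢
  simp only [funext_iff, Subtype.forall]
  refine forall₂_congr fun i hi => ?_
  rw [add_comm, eval_add, hp i hi, zero_add]
  rfl

theorem direction_zeroSet {p : Fin d → F} (hp : p ∈ zeroSet F L B) :
    (zeroSet F L B).direction = LinearMap.ker (coeffMatrix F L B).mulVecLin := by
  ext v
  rw [← AffineSubspace.vadd_mem_iff_mem_direction v hp, vadd_eq_add, vadd_mem_zeroSet_iff hp]
  rfl

theorem IsIndep.finrank_direction_zeroSet (h : IsIndep F L B) :
    Module.finrank F (zeroSet F L B).direction + B.card = d := by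
  obtain ⟨p, hp⟩ := h.nonempty_zeroSet
  have hrank : Module.finrank F (LinearMap.range (coeffMatrix F L B).mulVecLin) = B.card :=
    h.rank_matrix.trans (Fintype.card_coe B)
  have := LinearMap.finrank_range_add_finrank_ker (coeffMatrix F L B).mulVecLin
  rw [hrank, Module.finrank_fin_fun] at this
  rw [direction_zeroSet hp, add_comm, this]

theorem IsIndep.exists_superset_zeroSet_eq {B₀ T : Finset ι} (hB₀ : IsIndep F L B₀) (hsub : B₀ ⊆ T)
    (hT : (zeroSet F L T : Set (Fin d → F)).Nonempty) :
    ∃ B, B₀ ⊆ B ∧ IsIndep F L B ∧ zeroSet F L B = zeroSet F L T := by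
  classical
  let v (i : ι) (j : Fin d) : F := algebraMap R F ((L i).coeff j)
  have hindep : LinearIndepOn F v (B₀ : Set ι) := hB₀
  obtain ⟨C, hCT, hC₀, hspan, hC⟩ :=
    exists_linearIndepOn_extension hindep (Finset.coe_subset.2 hsub)
  lift C to Finset ι using T.finite_toSet.subset hCT
  refine ⟨C, mod_cast hC₀, hC,
    le_antisymm (le_zeroSet_iff.2 fun i hi => ?_) (zeroSet_anti (mod_cast hCT))⟩
  obtain ⟨p, hp⟩ := hT
  have hpC : p ∈ zeroSet F L C := zeroSet_anti (mod_cast hCT) hp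
  intro w hw
  obtain ⟨u, rfl⟩ : ∃ u, u + p = w := ⟨w - p, sub_add_cancel w p⟩
  have hu : v '' C ⊆ LinearMap.ker (Fintype.linearCombination F u) := by
    rintro _ ⟨j, hj, rfl⟩
    exact congrFun ((vadd_mem_zeroSet_iff hpC).1 hw) ⟨j, hj⟩
  have hi0 : v i ⬝ᵥ u = 0 := Submodule.span_le.2 hu (hspan ⟨i, hi, rfl⟩)
  rw [mem_zeroLocus, add_comm, eval_add, mem_zeroSet.1 hp i hi, zero_add, hi0]

theorem isFlat_arrangement_iff [Fintype ι] {x : AffineSubspace F (Fin d → F)} :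
    (arrangement F L).IsFlat x ↔ ∃ B, IsIndep F L B ∧ zeroSet F L B = x := by
  classical
  constructor
  · rintro ⟨hx, S, hS, rfl⟩
    obtain ⟨T, -, rfl⟩ := Finset.subset_image_iff.1 hS
    have hT : zeroSet F L T =
        (arrangement F L).ambient ⊓ (T.image fun i => (L i).zeroLocus F).inf id := by
      rw [Finset.inf_image, Function.id_comp]
      exact (top_inf_eq _).symm
    rw [← hT] at hx ⊢
    have hempty : IsIndep F L ∅ := linearIndependent_empty_type
    obtain ⟨B, -, hB, hBT⟩ := hempty.exists_superset_zeroSet_eq T.empty_subset hx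
    exact ⟨B, hB, hBT⟩
  · rintro ⟨B, hB, rfl⟩
    refine ⟨hB.nonempty_zeroSet, B.image fun i => (L i).zeroLocus F,
      Finset.image_subset_image fun i hi => Finset.mem_filter.2 ⟨Finset.mem_univ i, ?_⟩, ?_⟩
    · by_contra hconst
      simp only [IsNonconstant, not_exists, not_not] at hconst
      exact LinearIndependent.ne_zero (⟨i, hi⟩ : B) hB (funext hconst)
    · rw [Finset.inf_image, Function.id_comp]
      exact (top_inf_eq _).symm

theorem IsIndep.codim_eq_card [Fintype ι] {x : (arrangement F L).IntPoset}
    (h : IsIndep F L B) (hx : zeroSet F L B = x.1) : (arrangement F L).codim x = B.card := by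
  have hd : Module.finrank F (arrangement F L).ambient.direction = d := by
    change Module.finrank F (⊤ : AffineSubspace F (Fin d → F)).direction = d
    rw [AffineSubspace.direction_top, finrank_top, Module.finrank_fin_fun]
  have := h.finrank_direction_zeroSet
  rw [Arrangement.codim, hd, ← hx]
  omega

end Field

section Reduction

variable {R : Type*} [CommRing R] {d : ℕ} {ι : Type*} {K k : Type*} [Field K] [Algebra R K]
  [FaithfulSMul R K] [Field k] [Algebra R k] {L : ι → AffineForm R d} {B : Finset ι}

variable (K) in
theorem IsIndep.of_faithfulSMul (h : IsIndep k L B) : IsIndep K L B := by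
  classical
  obtain ⟨f, hf⟩ := isIndep_iff_exists_minor.1 h
  refine isIndep_iff_exists_minor.2 ⟨f, fun h0 => hf ?_⟩
  rw [(FaithfulSMul.algebraMap_injective R K) (h0.trans (map_zero _).symm), map_zero]

/-- Cramer's rule: the denominator of the coefficients that express `f` through the forms in `B`
is a minor of the coefficient matrix that does not vanish in `k`. -/
theorem IsIndep.exists_relation (h : IsIndep k L B) {f : AffineForm R d}
    (hf : zeroSet K L B ≤ f.zeroLocus K) :
    ∃ (a : R) (c : B → R), algebraMap R k a ≠ 0 ∧
      ∀ z : Fin d → R, a * f.eval z = ∑ b, c b * (L b).eval z := by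
  classical
  obtain ⟨φ, hφ⟩ := isIndep_iff_exists_minor.1 h
  obtain ⟨N, hN⟩ := (h.of_faithfulSMul K).exists_coeffMatrix_mul_eq_one
  let M := (coeffMatrix R L B).submatrix id φ
  let r (j : Fin d) : K := algebraMap R K (f.coeff j)
  let g : B → K := r ᵥ* N
  let c : B → R := (fun b => f.coeff (φ b)) ᵥ* M.adjugate
  have heval (v : Fin d → K) : f.eval v = g ⬝ᵥ fun b : B => (L b).eval v := by
    have hv : f.eval (v - N *ᵥ fun b : B => (L b).eval v) = 0 :=
      hf (mem_zeroSet.2 fun i hi => eval_sub_mulVec_eval hN v ⟨i, hi⟩)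
    rwa [eval_sub, sub_eq_zero, dotProduct_mulVec] at hv
  have hcoeff : r = g ᵥ* coeffMatrix K L B := dotProduct_eq _ _ fun w => by
    have hw := heval (0 + w)
    simp only [eval_add, heval 0] at hw
    rw [← dotProduct_mulVec]
    exact add_left_cancel (hw.trans (dotProduct_add _ _ _))
  have hc (b : B) : algebraMap R K (c b) = algebraMap R K M.det * g b := by
    let MK := (coeffMatrix K L B).submatrix id φ
    calc algebraMap R K (c b) = ((r ∘ φ) ᵥ* MK.adjugate) b := by
          rw [RingHom.map_vecMul, ← RingHom.mapMatrix_apply, RingHom.map_adjugate]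
          rfl
      _ = (g ᵥ* (MK * MK.adjugate)) b := by
          rw [← vecMul_vecMul, hcoeff]
          rfl
      _ = algebraMap R K M.det * g b := by
          rw [mul_adjugate, vecMul_smul, vecMul_one, algebraMap_det_submatrix_coeffMatrix]
          rfl
  have hmap (e : AffineForm R d) (z : Fin d → R) :
      algebraMap R K (e.eval z) = e.eval fun j => algebraMap R K (z j) :=
    map_eval (Algebra.ofId R K) e z
  refine ⟨M.det, c, hφ, fun z => FaithfulSMul.algebraMap_injective R K ?_⟩
  simp only [map_mul, map_sum, hmap, hc, heval, dotProduct, Finset.mul_sum, mul_assoc]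

theorem IsIndep.zeroSet_le_zeroLocus (h : IsIndep k L B) {f : AffineForm R d}
    (hf : zeroSet K L B ≤ f.zeroLocus K) : zeroSet k L B ≤ f.zeroLocus k := by
  obtain ⟨a, c, ha, hac⟩ := h.exists_relation hf
  intro p hp
  have hrel := mul_eval_eq_sum_of_forall hac p
  rw [Finset.sum_eq_zero fun b _ => by rw [mem_zeroSet.1 hp b b.2, mul_zero]] at hrel
  exact (mul_eq_zero.1 hrel).resolve_left ha

theorem IsIndep.zeroSet_le_zeroSet {B' : Finset ι} (h : IsIndep k L B)
    (hle : zeroSet K L B ≤ zeroSet K L B') : zeroSet k L B ≤ zeroSet k L B' :=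
  le_zeroSet_iff.2 fun i hi => h.zeroSet_le_zeroLocus (le_zeroSet_iff.1 hle i hi)

variable [Fintype ι]

/-- Since reduction can only merge flats, it is a bijection as soon as no flat is lost. -/
theorem exists_bijective_lift
    (hcard : Fintype.card (arrangement K L).IntPoset ≤ Fintype.card (arrangement k L).IntPoset) :
    ∃ φ : (arrangement k L).IntPoset → (arrangement K L).IntPoset, Function.Bijective φ ∧
      ∀ y, ∃ B, IsIndep k L B ∧ zeroSet k L B = y.1 ∧ zeroSet K L B = (φ y).1 := by
  choose B hB hBy using fun y : (arrangement k L).IntPoset => isFlat_arrangement_iff.1 y.2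
  let φ (y : (arrangement k L).IntPoset) : (arrangement K L).IntPoset :=
    ⟨zeroSet K L (B y), isFlat_arrangement_iff.2 ⟨B y, (hB y).of_faithfulSMul K, rfl⟩⟩
  have hφ : Function.Injective φ := fun y y' h => by
    have heq : zeroSet K L (B y) = zeroSet K L (B y') := congrArg Subtype.val h
    refine Subtype.ext ?_
    rw [← hBy y, ← hBy y']
    exact le_antisymm ((hB y).zeroSet_le_zeroSet heq.le) ((hB y').zeroSet_le_zeroSet heq.ge)
  exact ⟨φ, hφ.bijective_of_nat_card_le (by simpa only [Nat.card_eq_fintype_card] using hcard),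
    fun y => ⟨B y, hB y, hBy y, rfl⟩⟩

theorem exists_isIndep_zeroSet_eq
    (hcard : Fintype.card (arrangement K L).IntPoset ≤ Fintype.card (arrangement k L).IntPoset)
    (x : (arrangement K L).IntPoset) : ∃ B, IsIndep k L B ∧ zeroSet K L B = x.1 := by
  obtain ⟨φ, hφ, hB⟩ := exists_bijective_lift hcard
  obtain ⟨y, rfl⟩ := hφ.2 x
  obtain ⟨B, hBk, -, hBy⟩ := hB y
  exact ⟨B, hBk, hBy⟩

theorem zeroSet_eq_of_zeroSet_eq
    (hcard : Fintype.card (arrangement K L).IntPoset ≤ Fintype.card (arrangement k L).IntPoset)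
    {B B' : Finset ι} (hB : IsIndep k L B) (hB' : IsIndep k L B')
    (h : zeroSet k L B = zeroSet k L B') : zeroSet K L B = zeroSet K L B' := by
  obtain ⟨φ, hφ, hlift⟩ := exists_bijective_lift hcard
  have key {C : Finset ι} (hC : IsIndep k L C) :
      zeroSet K L C = (φ ⟨zeroSet k L C, isFlat_arrangement_iff.2 ⟨C, hC, rfl⟩⟩).1 := by
    obtain ⟨y, hy⟩ := hφ.2 ⟨zeroSet K L C, isFlat_arrangement_iff.2 ⟨C, hC.of_faithfulSMul K, rfl⟩⟩
    obtain ⟨D, hD, hDy, hDφ⟩ := hlift y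
    have hDC : zeroSet K L D = zeroSet K L C := hDφ.trans (congrArg Subtype.val hy)
    have hyC : y.1 = zeroSet k L C := hDy.symm.trans
      (le_antisymm (hD.zeroSet_le_zeroSet hDC.le) (hC.zeroSet_le_zeroSet hDC.ge))
    rw [← hDC, hDφ]
    congr 1
    exact congrArg φ (Subtype.ext hyC)
  rw [key hB, key hB']
  simp only [h]

variable (k L) in
open Classical in
/-- The reduction of a flat `x` over `K`: the common zeros over `k` of the forms that vanish
on `x`. -/
def reduction (x : AffineSubspace K (Fin d → K)) : AffineSubspace k (Fin d → k) :=
  zeroSet k L {i | x ≤ (L i).zeroLocus K}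

omit [FaithfulSMul R K] in
theorem mem_reduction {x : AffineSubspace K (Fin d → K)} {p : Fin d → k} :
    p ∈ reduction k L x ↔ ∀ i, x ≤ (L i).zeroLocus K → (L i).eval p = 0 := by
  simp [reduction, mem_zeroSet]

theorem IsIndep.reduction_zeroSet (h : IsIndep k L B) :
    reduction k L (zeroSet K L B) = zeroSet k L B := by
  refine le_antisymm (fun p hp => mem_zeroSet.2 fun i hi => mem_reduction.1 hp i ?_)
    fun p hp => mem_reduction.2 fun i hi => h.zeroSet_le_zeroLocus hi hp
  exact le_zeroSet_iff.1 le_rfl i hi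

theorem exists_forall_mem_reduction_iff_le
    (hcard : Fintype.card (arrangement K L).IntPoset ≤ Fintype.card (arrangement k L).IntPoset)
    (p : Fin d → k) : ∃ x : (arrangement K L).IntPoset,
      ∀ w : (arrangement K L).IntPoset, p ∈ reduction k L w.1 ↔ w ≤ x := by
  classical
  let T : Finset ι := {i | (L i).eval p = 0}
  have hpT : p ∈ zeroSet k L T := mem_zeroSet.2 fun i hi => (Finset.mem_filter.1 hi).2
  have hempty : IsIndep k L ∅ := linearIndependent_empty_type
  obtain ⟨B, -, hB, hzB⟩ := hempty.exists_superset_zeroSet_eq T.empty_subset ⟨p, hpT⟩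
  refine ⟨⟨zeroSet K L B, isFlat_arrangement_iff.2 ⟨B, hB.of_faithfulSMul K, rfl⟩⟩,
    fun w => ⟨fun hp => ?_, fun hw => ?_⟩⟩
  · obtain ⟨C, hC, hCw⟩ := exists_isIndep_zeroSet_eq hcard w
    rw [← hCw, hC.reduction_zeroSet, mem_zeroSet] at hp
    have hCT : C ⊆ T := fun i hi => Finset.mem_filter.2 ⟨Finset.mem_univ i, hp i hi⟩
    obtain ⟨D, hCD, hD, hzD⟩ := hC.exists_superset_zeroSet_eq hCT ⟨p, hpT⟩
    change zeroSet K L B ≤ w.1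
    rw [zeroSet_eq_of_zeroSet_eq hcard hB hD (hzB.trans hzD.symm), ← hCw]
    exact zeroSet_anti hCD
  · have hle : zeroSet K L B ≤ w.1 := hw
    exact mem_reduction.2 fun i hi => hB.zeroSet_le_zeroLocus (hle.trans hi) (hzB ▸ hpT)

theorem natCard_reduction_mul_pow_codim [Finite k]
    (hcard : Fintype.card (arrangement K L).IntPoset ≤ Fintype.card (arrangement k L).IntPoset)
    (x : (arrangement K L).IntPoset) :
    Nat.card (reduction k L x.1) * Nat.card k ^ (arrangement K L).codim x = Nat.card k ^ d := by
  obtain ⟨B, hB, hBx⟩ := exists_isIndep_zeroSet_eq hcard x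
  obtain ⟨p, hp⟩ := hB.nonempty_zeroSet
  have hpt : Nat.card (zeroSet k L B).direction = Nat.card (zeroSet k L B) :=
    have : Nonempty (zeroSet k L B) := ⟨p, hp⟩
    Nat.card_congr (Equiv.vaddConst ⟨p, hp⟩)
  rw [(hB.of_faithfulSMul K).codim_eq_card hBx, ← hBx, hB.reduction_zeroSet, ← hpt,
    Module.natCard_eq_pow_finrank (K := k), ← pow_add, hB.finrank_direction_zeroSet]

theorem exists_lift_of_mem_reduction {𝔬 : Type*} [CommRing 𝔬] [IsLocalRing 𝔬] [Algebra R 𝔬]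
    (hcard : Fintype.card (arrangement K L).IntPoset ≤
      Fintype.card (arrangement (ResidueField 𝔬) L).IntPoset)
    {x : (arrangement K L).IntPoset} {p : Fin d → ResidueField 𝔬}
    (hp : p ∈ reduction (ResidueField 𝔬) L x.1) :
    ∃ z : Fin d → 𝔬, (∀ j, residue 𝔬 (z j) = p j) ∧
      ∀ i, x.1 ≤ (L i).zeroLocus K → (L i).eval z = 0 := by
  classical
  obtain ⟨B, hB, hBx⟩ := exists_isIndep_zeroSet_eq hcard x
  rw [← hBx] at hp ⊢
  rw [hB.reduction_zeroSet, mem_zeroSet] at hp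
  have hunit {a : R} (ha : algebraMap R (ResidueField 𝔬) a ≠ 0) : IsUnit (algebraMap R 𝔬 a) :=
    residue_ne_zero_iff_isUnit _ |>.1 ha
  obtain ⟨φ, hφ⟩ := isIndep_iff_exists_minor.1 hB
  obtain ⟨N, hN⟩ := exists_coeffMatrix_mul_eq_one (hunit hφ)
  choose v hv using fun j => residue_surjective (p j)
  have hvB (b : B) : residue 𝔬 ((L b).eval v) = 0 := by
    rw [residue_eval, funext hv]
    exact hp b b.2
  refine ⟨v - N *ᵥ fun b : B => (L b).eval v, fun j => ?_, fun i hi => ?_⟩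
  · simp [mulVec, dotProduct, hv, hvB]
  · obtain ⟨a, c, ha, hac⟩ := hB.exists_relation hi
    have hrel := mul_eval_eq_sum_of_forall hac (v - N *ᵥ fun b : B => (L b).eval v)
    simp only [eval_sub_mulVec_eval hN, mul_zero, Finset.sum_const_zero] at hrel
    exact (hunit ha).mul_right_eq_zero.1 hrel

end Reduction

end AffineForm

section DVRAbs

variable {𝔬 : Type*} [CommRing 𝔬] [IsDomain 𝔬] [IsDiscreteValuationRing 𝔬]

theorem dvrAbs_zero : dvrAbs (0 : 𝔬) = 0 := by simp [dvrAbs]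

theorem dvrAbs_of_ne_zero {a : 𝔬} (ha : a ≠ 0) : dvrAbs a =
    ((residueCard 𝔬 : NNReal)⁻¹) ^ (IsDiscreteValuationRing.addVal 𝔬 a).toNat := by
  simp [dvrAbs, ha]

theorem dvrAbs_uniformizer_mul {ϖ : 𝔬} (hϖ : Irreducible ϖ) (a : 𝔬) :
    dvrAbs (ϖ * a) = (residueCard 𝔬 : NNReal)⁻¹ * dvrAbs a := by
  by_cases ha : a = 0
  · simp [ha, dvrAbs_zero]
  · rw [dvrAbs_of_ne_zero ha, dvrAbs_of_ne_zero (mul_ne_zero hϖ.ne_zero ha),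
      IsDiscreteValuationRing.addVal_mul, IsDiscreteValuationRing.addVal_uniformizer hϖ,
      ENat.toNat_add (by simp) (IsDiscreteValuationRing.addVal_eq_top_iff.not.2 ha),
      ENat.toNat_one, pow_add, pow_one]

theorem dvrAbs_eq_one_of_isUnit {a : 𝔬} (ha : IsUnit a) : dvrAbs a = 1 := by
  rw [dvrAbs_of_ne_zero ha.ne_zero, IsDiscreteValuationRing.addVal_eq_zero_iff.2 ha,
    ENat.toNat_zero, pow_zero]

theorem dvrAbs_eq_one_of_residue_ne_zero {a : 𝔬} (ha : residue 𝔬 a ≠ 0) : dvrAbs a = 1 :=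
  dvrAbs_eq_one_of_isUnit (by rwa [← notMem_maximalIdeal, ← residue_eq_zero_iff])

theorem dvrAbs_le_of_dvd {a b : 𝔬} (h : a ∣ b) : dvrAbs b ≤ dvrAbs a := by
  by_cases hb : b = 0
  · simp [hb, dvrAbs_zero]
  · rw [dvrAbs_of_ne_zero (ne_zero_of_dvd_ne_zero hb h), dvrAbs_of_ne_zero hb]
    exact pow_le_pow_of_le_one zero_le (Nat.cast_inv_le_one _) <|
      ENat.toNat_le_toNat (IsDiscreteValuationRing.addVal_le_iff_dvd.2 h)
        (IsDiscreteValuationRing.addVal_eq_top_iff.not.2 hb)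

theorem dvrAbs_le_one (a : 𝔬) : dvrAbs a ≤ 1 :=
  (dvrAbs_le_of_dvd (one_dvd a)).trans_eq (dvrAbs_eq_one_of_isUnit isUnit_one)

theorem dvrAbs_add_le (a b : 𝔬) : dvrAbs (a + b) ≤ max (dvrAbs a) (dvrAbs b) := by
  rcases le_total (IsDiscreteValuationRing.addVal 𝔬 a) (IsDiscreteValuationRing.addVal 𝔬 b) with
    h | h <;> rw [IsDiscreteValuationRing.addVal_le_iff_dvd] at h
  · exact (dvrAbs_le_of_dvd ((dvd_refl a).add h)).trans (le_max_left _ _)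
  · exact (dvrAbs_le_of_dvd (h.add (dvd_refl b))).trans (le_max_right _ _)

theorem dvrAbs_uniformizer_pow {ϖ : 𝔬} (hϖ : Irreducible ϖ) (n : ℕ) :
    dvrAbs (ϖ ^ n) = (residueCard 𝔬 : NNReal)⁻¹ ^ n := by
  induction n with
  | zero => simpa using dvrAbs_eq_one_of_isUnit (isUnit_one (M := 𝔬))
  | succ n ih => rw [pow_succ', dvrAbs_uniformizer_mul hϖ, ih, pow_succ']

theorem one_lt_residueCard (𝔬 : Type*) [CommRing 𝔬] [IsLocalRing 𝔬] [Finite (ResidueField 𝔬)] :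
    1 < residueCard 𝔬 :=
  Finite.one_lt_card

theorem measurable_dvrAbs [Finite (ResidueField 𝔬)] [TopologicalSpace 𝔬] [IsTopologicalRing 𝔬]
    [MeasurableSpace 𝔬] [OpensMeasurableSpace 𝔬] (h : IsAdic (maximalIdeal 𝔬)) :
    Measurable (dvrAbs : 𝔬 → NNReal) := by
  obtain ⟨ϖ, hϖ⟩ := IsDiscreteValuationRing.exists_irreducible 𝔬
  refine measurable_of_Iio fun r => IsOpen.measurableSet (isOpen_iff_mem_nhds.2 fun a ha => ?_)
  obtain ⟨n, hn⟩ := exists_pow_lt_of_lt_one (zero_le.trans_lt ha)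
    (inv_lt_one_of_one_lt₀ (Nat.one_lt_cast.2 (one_lt_residueCard 𝔬)) :
      (residueCard 𝔬 : NNReal)⁻¹ < 1)
  have hnear : (fun b => b - a) ⁻¹' ((maximalIdeal 𝔬 ^ n : Ideal 𝔬) : Set 𝔬) ∈ nhds a :=
    (((isAdic_iff.1 h).1 n).preimage (continuous_id.sub continuous_const)).mem_nhds (by simp)
  filter_upwards [hnear] with b hb
  have hdvd : ϖ ^ n ∣ b - a := by
    rwa [← Ideal.mem_span_singleton, ← Ideal.span_singleton_pow, ← hϖ.maximalIdeal_eq]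
  calc dvrAbs b = dvrAbs (a + (b - a)) := by rw [add_sub_cancel]
    _ ≤ max (dvrAbs a) (dvrAbs (b - a)) := dvrAbs_add_le _ _
    _ < r := max_lt ha ((dvrAbs_le_of_dvd hdvd).trans_lt (by rwa [dvrAbs_uniformizer_pow hϖ]))

end DVRAbs

section Adic

variable {𝔬 : Type*} [CommRing 𝔬] [TopologicalSpace 𝔬] [IsTopologicalRing 𝔬] [CompactSpace 𝔬]

theorem secondCountableTopology_of_isAdic {I : Ideal 𝔬} (hI : IsAdic I) :
    SecondCountableTopology 𝔬 := by
  let _ : UniformSpace 𝔬 := IsTopologicalAddGroup.rightUniformSpace 𝔬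
  have : IsUniformAddGroup 𝔬 := isUniformAddGroup_of_addCommGroup
  have : (nhds (0 : 𝔬)).IsCountablyGenerated := hI.hasBasis_nhds_zero.isCountablyGenerated
  have := IsUniformAddGroup.uniformity_countably_generated (α := 𝔬)
  let _ := UniformSpace.pseudoMetricSpace 𝔬
  exact EMetric.secondCountable_of_sigmaCompact 𝔬

theorem finite_residueField_of_isAdic [IsLocalRing 𝔬] (h : IsAdic (maximalIdeal 𝔬)) :
    Finite (ResidueField 𝔬) :=
  AddSubgroup.quotient_finite_of_isOpen (maximalIdeal 𝔬).toAddSubgroup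
    (by simpa using (isAdic_iff.1 h).1 1)

end Adic

section CubeHaar

variable {𝔬 : Type*} [CommRing 𝔬] [TopologicalSpace 𝔬] [IsTopologicalRing 𝔬] [CompactSpace 𝔬]
  [MeasurableSpace 𝔬] [BorelSpace 𝔬] {d : ℕ}

instance [SecondCountableTopology 𝔬] : (cubeHaar 𝔬 d).IsAddHaarMeasure :=
  inferInstanceAs (Measure.pi fun _ => Measure.addHaarMeasure _).IsAddHaarMeasure

instance [SecondCountableTopology 𝔬] : IsProbabilityMeasure (cubeHaar 𝔬 d) where
  measure_univ := by
    have huniv : Measure.addHaarMeasure (⊤ : TopologicalSpace.PositiveCompacts 𝔬) Set.univ = 1 :=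
      Measure.addHaarMeasure_self
    simp [cubeHaar, Measure.pi_univ, huniv]

variable [SecondCountableTopology 𝔬] [IsLocalRing 𝔬]
  {ϖ : 𝔬} (hϖ : maximalIdeal 𝔬 = Ideal.span {ϖ})
  {σ : (Fin d → ResidueField 𝔬) → Fin d → 𝔬} (hσ : ∀ p j, residue 𝔬 (σ p j) = p j)

include hϖ in
omit [TopologicalSpace 𝔬] [IsTopologicalRing 𝔬] [CompactSpace 𝔬] [MeasurableSpace 𝔬]
  [BorelSpace 𝔬] [SecondCountableTopology 𝔬] in
theorem exists_eq_add_smul {v w : Fin d → 𝔬} (h : ∀ j, residue 𝔬 (v j) = residue 𝔬 (w j)) :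
    ∃ u, v = w + ϖ • u := by
  have hdvd : ∀ j, ∃ u, v j - w j = ϖ * u := fun j => by
    have hmem : v j - w j ∈ maximalIdeal 𝔬 := by
      rw [← residue_eq_zero_iff, map_sub, h j, sub_self]
    rwa [hϖ, Ideal.mem_span_singleton] at hmem
  choose u hu using hdvd
  exact ⟨u, funext fun j => by simp [← hu]⟩

section Fintype

variable [Fintype (ResidueField 𝔬)]

include hϖ hσ in
theorem isAddLeftInvariant_sum_map_cubeHaar :
    (∑ p, (cubeHaar 𝔬 d).map fun z => σ p + ϖ • z).IsAddLeftInvariant := by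
  refine ⟨fun g => ?_⟩
  ext s hs
  let γ : Fin d → ResidueField 𝔬 := fun j => residue 𝔬 (g j)
  have hpiece (p : Fin d → ResidueField 𝔬) :
      cubeHaar 𝔬 d ((fun z => σ p + ϖ • z) ⁻¹' ((g + ·) ⁻¹' s)) =
        cubeHaar 𝔬 d ((fun z => σ (γ + p) + ϖ • z) ⁻¹' s) := by
    obtain ⟨u, hu⟩ := exists_eq_add_smul hϖ (v := g + σ p) (w := σ (γ + p))
      fun j => by simp [hσ, γ]
    rw [← measure_preimage_add (cubeHaar 𝔬 d) u ((fun z => σ (γ + p) + ϖ • z) ⁻¹' s)]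
    congr 1
    ext z
    simp only [Set.mem_preimage, smul_add, ← add_assoc, hu]
  rw [Measure.map_apply (measurable_const_add g) hs, Measure.finsetSum_apply,
    Measure.finsetSum_apply]
  refine Fintype.sum_equiv (Equiv.addLeft γ) _ _ fun p => ?_
  rw [Measure.map_apply (by fun_prop) (measurable_const_add g hs),
    Measure.map_apply (by fun_prop) hs, hpiece]
  rfl

include hϖ hσ in
theorem sum_map_cubeHaar : ∑ p, (cubeHaar 𝔬 d).map (fun z => σ p + ϖ • z) =
    (residueCard 𝔬 : ENNReal) ^ d • cubeHaar 𝔬 d := by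
  have hmap (p : Fin d → ResidueField 𝔬) :
      IsProbabilityMeasure ((cubeHaar 𝔬 d).map fun z => σ p + ϖ • z) :=
    Measure.isProbabilityMeasure_map (by fun_prop)
  have := isAddLeftInvariant_sum_map_cubeHaar (d := d) hϖ hσ
  have hsmul := Measure.isAddInvariant_eq_smul_of_compactSpace
    (∑ p, (cubeHaar 𝔬 d).map fun z => σ p + ϖ • z) (cubeHaar 𝔬 d)
  have hmass := congrArg (· Set.univ) hsmul
  simp only [Measure.finsetSum_apply, measure_univ, Finset.sum_const, Finset.card_univ,
    Fintype.card_fun, Fintype.card_fin, nsmul_eq_mul, mul_one, Measure.smul_apply,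
    ENNReal.smul_def, smul_eq_mul] at hmass
  rw [hsmul, ← Measure.coe_nnreal_smul, ← hmass, residueCard, Nat.card_eq_fintype_card,
    Nat.cast_pow]

include hϖ hσ in
theorem sum_lintegral_add_smul {f : (Fin d → 𝔬) → ENNReal} (hf : Measurable f) :
    ∑ p, ∫⁻ z, f (σ p + ϖ • z) ∂cubeHaar 𝔬 d =
      (residueCard 𝔬 : ENNReal) ^ d * ∫⁻ z, f z ∂cubeHaar 𝔬 d := by
  rw [← smul_eq_mul, ← lintegral_smul_measure, ← sum_map_cubeHaar hϖ hσ,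
    lintegral_finsetSum_measure]
  exact Finset.sum_congr rfl fun p _ => (lintegral_map hf (by fun_prop)).symm

end Fintype

variable {f : (Fin d → 𝔬) → ℂ} (hf : Measurable f)
  (hint : ∀ p, Integrable (fun z => f (σ p + ϖ • z)) (cubeHaar 𝔬 d))

include hϖ hσ hf hint in
theorem integrable_cubeHaar_of_forall_add_smul [Finite (ResidueField 𝔬)] :
    Integrable f (cubeHaar 𝔬 d) := by
  have := Fintype.ofFinite (ResidueField 𝔬)
  have hsum : Integrable f ((residueCard 𝔬 : ENNReal) ^ d • cubeHaar 𝔬 d) := by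
    rw [← sum_map_cubeHaar hϖ hσ, integrable_finsetSum_measure]
    exact fun p _ => (integrable_map_measure hf.aestronglyMeasurable (by fun_prop)).2 (hint p)
  exact (integrable_smul_measure (by simp [(zero_lt_one.trans (one_lt_residueCard 𝔬)).ne'])
    (by finiteness)).1 hsum

include hϖ hσ hf hint in
theorem sum_integral_add_smul [Fintype (ResidueField 𝔬)] :
    ∑ p, ∫ z, f (σ p + ϖ • z) ∂cubeHaar 𝔬 d =
      (residueCard 𝔬 : ℂ) ^ d * ∫ z, f z ∂cubeHaar 𝔬 d := by
  have hmap (p : Fin d → ResidueField 𝔬) :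
      Integrable f ((cubeHaar 𝔬 d).map fun z => σ p + ϖ • z) :=
    (integrable_map_measure hf.aestronglyMeasurable (by fun_prop)).2 (hint p)
  calc ∑ p, ∫ z, f (σ p + ϖ • z) ∂cubeHaar 𝔬 d
      = ∑ p, ∫ z, f z ∂(cubeHaar 𝔬 d).map fun z => σ p + ϖ • z :=
        Finset.sum_congr rfl fun p _ =>
          (integral_map (by fun_prop) hf.aestronglyMeasurable).symm
    _ = ∫ z, f z ∂((residueCard 𝔬 : ENNReal) ^ d • cubeHaar 𝔬 d) := by
        rw [← sum_map_cubeHaar hϖ hσ, integral_finsetSum_measure fun p _ => hmap p]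
    _ = (residueCard 𝔬 : ℂ) ^ d * ∫ z, f z ∂cubeHaar 𝔬 d := by
        rw [integral_smul_measure]
        simp

end CubeHaar

theorem lintegral_ne_top_of_forall_lintegral_min_le {α : Type*} [MeasurableSpace α]
    {μ : Measure α} [IsFiniteMeasure μ] {f : α → ENNReal} (hf : Measurable f)
    {a b c : ENNReal} (hb : b ≠ ⊤) (hc : c < a)
    (h : ∀ n : ℕ, a * ∫⁻ x, min (f x) n ∂μ ≤ b + c * ∫⁻ x, min (f x) n ∂μ) :
    ∫⁻ x, f x ∂μ ≠ ⊤ := by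
  have hpos : a - c ≠ 0 := (tsub_pos_of_lt hc).ne'
  have hle (n : ℕ) : ∫⁻ x, min (f x) n ∂μ ≤ b / (a - c) := by
    have hfin : ∫⁻ x, min (f x) n ∂μ ≠ ⊤ :=
      ((lintegral_mono fun x => min_le_right (f x) n).trans_lt
        (by simpa using ENNReal.mul_lt_top (by simp) (measure_lt_top μ _))).ne
    rw [ENNReal.le_div_iff_mul_le (.inl hpos) (.inr hb), mul_comm,
      ENNReal.sub_mul fun _ _ => hfin]
    exact tsub_le_iff_right.2 (h n)
  have hsup (x : α) : ⨆ n : ℕ, min (f x) n = f x := by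
    simp only [← inf_iSup_eq, ENNReal.iSup_natCast, inf_top_eq]
  have hmono : Monotone fun (n : ℕ) x => min (f x) n := fun m n hmn x =>
    min_le_min_left _ (Nat.cast_le.2 hmn)
  rw [← lintegral_congr hsup, lintegral_iSup (fun n => hf.min measurable_const) hmono]
  exact ((iSup_le hle).trans_lt (ENNReal.div_lt_top hb hpos)).ne

theorem Arrangement.exists_isGLB_pair {k V : Type*} [Field k] [AddCommGroup V] [Module k V]
    {A : Arrangement k V} (x y : A.IntPoset) : ∃ m, IsGLB {x, y} m := by
  classical
  let S := A.members.filter fun H => x.1 ≤ H ∧ y.1 ≤ H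
  have hx : x.1 ≤ A.ambient ⊓ S.inf id :=
    le_inf x.le_ambient (Finset.le_inf fun H hH => (Finset.mem_filter.1 hH).2.1)
  have hy : y.1 ≤ A.ambient ⊓ S.inf id :=
    le_inf y.le_ambient (Finset.le_inf fun H hH => (Finset.mem_filter.1 hH).2.2)
  refine ⟨⟨A.ambient ⊓ S.inf id, x.2.1.mono hx, S, Finset.filter_subset _ _, rfl⟩, ?_, ?_⟩
  · rintro z (rfl | rfl)
    exacts [hx, hy]
  · intro z hz p hp
    have hxz : x.1 ≤ z.1 := hz (Set.mem_insert x _)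
    have hyz : y.1 ≤ z.1 := hz (Set.mem_insert_of_mem x rfl)
    exact (isFlat_iff.1 z.2).2.2 p hp.1 fun H hH hzH =>
      mem_finsetInf_iff.1 hp.2 H (Finset.mem_filter.2 ⟨hH, hxz.trans hzH, hyz.trans hzH⟩)

namespace AffineForm

section Integrand

variable {R : Type*} [CommRing R] {d : ℕ} {ι : Type*} [Fintype ι]
  {K : Type*} [Field K] [Algebra R K] {L : ι → AffineForm R d}
  {𝔬 : Type*} [CommRing 𝔬] [IsDomain 𝔬] [IsDiscreteValuationRing 𝔬] [Algebra R 𝔬]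

theorem normSub_add_smul {x : AffineSubspace K (Fin d → K)} {v : Fin d → 𝔬}
    (hv : ∀ i, x ≤ (L i).zeroLocus K → (L i).eval v = 0) {ϖ : 𝔬} (hϖ : Irreducible ϖ)
    (z : Fin d → 𝔬) :
    normSub K L x (v + ϖ • z) = (residueCard 𝔬 : NNReal)⁻¹ * normSub K L x (v + z) := by
  classical
  rw [normSub, normSub, NNReal.mul_finset_sup]
  refine Finset.sup_congr rfl fun i hi => ?_
  have hvi := hv i (Finset.mem_filter.1 hi).2
  rw [← dvrAbs_uniformizer_mul hϖ, eval_add, eval_add, hvi, dotProduct_smul, zero_add,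
    zero_add, smul_eq_mul]

theorem normSub_eq_one {x : AffineSubspace K (Fin d → K)} {z : Fin d → 𝔬}
    (h : (fun j => residue 𝔬 (z j)) ∉ reduction (ResidueField 𝔬) L x) :
    normSub K L x z = 1 := by
  classical
  rw [mem_reduction] at h
  push Not at h
  obtain ⟨i, hi, hiz⟩ := h
  refine le_antisymm (Finset.sup_le fun _ _ => dvrAbs_le_one _) ?_
  rw [← residue_eval] at hiz
  rw [← dvrAbs_eq_one_of_residue_ne_zero hiz]
  exact Finset.le_sup (f := fun i => dvrAbs ((L i).eval z)) (by simpa using hi)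

theorem measurable_normSub [Finite (ResidueField 𝔬)] [TopologicalSpace 𝔬] [IsTopologicalRing 𝔬]
    [MeasurableSpace 𝔬] [BorelSpace 𝔬] [SecondCountableTopology 𝔬]
    (hadic : IsAdic (maximalIdeal 𝔬)) (x : AffineSubspace K (Fin d → K)) :
    Measurable (normSub K L x : (Fin d → 𝔬) → NNReal) := by
  classical
  unfold normSub
  generalize (Finset.univ.filter fun i => x ≤ (L i).zeroLocus K) = T
  induction T using Finset.induction_on with
  | empty => exact measurable_const
  | insert i T _ ih =>
    simp only [Finset.sup_insert]
    exact Measurable.max ((measurable_dvrAbs hadic).comp (by unfold eval; fun_prop)) ih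

open Classical in
/-- The factor of `zetaIntegrand` that belongs to the flats in `D`. -/
def partialIntegrand (D : Set (arrangement K L).IntPoset) (s : (arrangement K L).Nonbot → ℂ)
    (z : Fin d → 𝔬) : ℂ :=
  ∏ x : (arrangement K L).Nonbot with x.1 ∈ D, (((normSub K L x.1.1 z : NNReal) : ℝ) : ℂ) ^ s x

variable (s : (arrangement K L).Nonbot → ℂ)

theorem partialIntegrand_univ :
    (partialIntegrand Set.univ s : (Fin d → 𝔬) → ℂ) = zetaIntegrand K L s := by
  classical
  funext z
  simp [partialIntegrand, zetaIntegrand]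

open Classical in
theorem partialIntegrand_Iic (y : (arrangement K L).IntPoset) (z : Fin d → 𝔬) :
    partialIntegrand (Set.Iic y) s z =
      ∏ x : (arrangement K L).Nonbot with x.1 ≤ y,
        (((normSub K L x.1.1 z : NNReal) : ℝ) : ℂ) ^ s x :=
  Finset.prod_congr (Finset.filter_congr_decidable _ _ _) fun _ _ => rfl

theorem partialIntegrand_Iic_bot (z : Fin d → 𝔬) : partialIntegrand (Set.Iic ⊥) s z = 1 := by
  classical
  rw [partialIntegrand, Finset.filter_false_of_mem fun x _ hx => x.2 (le_bot_iff.1 hx),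
    Finset.prod_empty]

theorem measurable_partialIntegrand [Finite (ResidueField 𝔬)] [TopologicalSpace 𝔬]
    [IsTopologicalRing 𝔬] [MeasurableSpace 𝔬] [BorelSpace 𝔬] [SecondCountableTopology 𝔬]
    (hadic : IsAdic (maximalIdeal 𝔬)) (D : Set (arrangement K L).IntPoset) :
    Measurable (partialIntegrand D s : (Fin d → 𝔬) → ℂ) := by
  classical
  exact Finset.measurable_fun_prod _ fun x _ => (Complex.measurable_ofReal.comp
    (measurable_coe_nnreal_real.comp (measurable_normSub hadic _))).pow_const _

open Classical in
/-- The factor by which scaling by a uniformizer about a point of `y` multiplies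
`partialIntegrand (Set.Iic y) s`. -/
def scalingFactor (q : ℂ) (y : (arrangement K L).IntPoset) : ℂ :=
  q ^ (-∑ x : (arrangement K L).Nonbot with x.1 ≤ y, s x)

theorem partialIntegrand_Iic_add_smul {y : (arrangement K L).IntPoset} {v : Fin d → 𝔬}
    (hv : ∀ i, y.1 ≤ (L i).zeroLocus K → (L i).eval v = 0) {ϖ : 𝔬} (hϖ : Irreducible ϖ)
    (hq : residueCard 𝔬 ≠ 0) (z : Fin d → 𝔬) :
    partialIntegrand (Set.Iic y) s (v + ϖ • z) =
      scalingFactor s (residueCard 𝔬) y * partialIntegrand (Set.Iic y) s (v + z) := by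
  classical
  have hexp : scalingFactor s (residueCard 𝔬) y =
      ∏ x : (arrangement K L).Nonbot with x.1 ≤ y, (residueCard 𝔬 : ℂ) ^ (-s x) := by
    simp only [scalingFactor, Complex.cpow_def_of_ne_zero (Nat.cast_ne_zero.2 hq),
      ← Finset.sum_neg_distrib, Finset.mul_sum, Complex.exp_sum]
  rw [hexp, partialIntegrand_Iic, partialIntegrand_Iic, ← Finset.prod_mul_distrib]
  refine Finset.prod_congr rfl fun x hx => ?_
  have hxy : y.1 ≤ x.1.1 := (Finset.mem_filter.1 hx).2
  rw [normSub_add_smul (fun i hi => hv i (hxy.trans hi)) hϖ, NNReal.coe_mul, Complex.ofReal_mul,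
    Complex.mul_cpow_ofReal_nonneg (NNReal.coe_nonneg _) (NNReal.coe_nonneg _), Complex.cpow_neg,
    ← Complex.inv_cpow _ _ (by simpa [Complex.natCast_arg] using Real.pi_ne_zero.symm)]
  simp

/-- On the residue class of `p` only the flats whose reduction contains `p` contribute. -/
theorem partialIntegrand_eq_of_forall {D : Set (arrangement K L).IntPoset}
    {y : (arrangement K L).IntPoset} {z : Fin d → 𝔬}
    (hy : ∀ x, x ≤ y ↔
      x ∈ D ∧ (fun j => residue 𝔬 (z j)) ∈ reduction (ResidueField 𝔬) L x.1) :
    partialIntegrand D s z = partialIntegrand (Set.Iic y) s z := by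
  classical
  refine (Finset.prod_subset ?_ fun x hxD hxy => ?_).symm
  · exact Finset.monotone_filter_right _ fun x _ hx => ((hy x.1).1 hx).1
  · rw [normSub_eq_one fun hx => hxy (Finset.mem_filter.2 ⟨Finset.mem_univ x,
      (hy x.1).2 ⟨(Finset.mem_filter.1 hxD).2, hx⟩⟩)]
    simp

end Integrand

end AffineForm

theorem Arrangement.codim_add_codim {k V : Type*} [Field k] [AddCommGroup V] [Module k V]
    [FiniteDimensional k V] {A B : Arrangement k V} {x : A.IntPoset} (hx : B.ambient = x.1)
    {z : B.IntPoset} (hz : A.IsFlat z.1) :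
    B.codim z + A.codim x = A.codim ⟨z.1, hz⟩ := by
  have hBz := finrank_direction_add_codim z
  have hAx := finrank_direction_add_codim x
  have hAz : Module.finrank k z.1.direction + A.codim ⟨z.1, hz⟩ = _ :=
    finrank_direction_add_codim ⟨z.1, hz⟩
  rw [hx] at hBz
  omega

namespace AffineForm

section ResidueClasses

variable {R : Type*} [CommRing R] {d : ℕ} {ι : Type*} [Fintype ι]
  {K : Type*} [Field K] [Algebra R K] {L : ι → AffineForm R d}
  {k : Type*} [Field k] [Algebra R k]

/-- Among the flats in `D` whose reductions contain `p`, the flat `m p` is the smallest subspace,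
that is, the largest element of the intersection poset. -/
def IsLeastFlatMap (D : Set (arrangement K L).IntPoset)
    (m : (Fin d → k) → (arrangement K L).IntPoset) : Prop :=
  ∀ p x, x ≤ m p ↔ x ∈ D ∧ p ∈ reduction k L x.1

open Classical in
theorem IsLeastFlatMap.sum_card_filter_eq [Fintype k] {D : Set (arrangement K L).IntPoset}
    {m : (Fin d → k) → (arrangement K L).IntPoset} (hm : IsLeastFlatMap D m)
    {x : (arrangement K L).IntPoset} {B : Arrangement K (Fin d → K)}
    (hB : ∀ w, B.IsFlat w ↔ ∃ h : (arrangement K L).IsFlat w, ⟨w, h⟩ ∈ D ∧ w ≤ x.1)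
    (z : B.IntPoset) :
    ∑ y : B.IntPoset with z ≤ y, Finset.card {p | (m p).1 = y.1} =
      Finset.card {p | (m p).1 ≤ z.1} := by
  have hdisj : ∀ y ∈ Finset.univ.filter (z ≤ ·), ∀ y' ∈ Finset.univ.filter (z ≤ ·), y ≠ y' →
      Disjoint (Finset.univ.filter fun p => (m p).1 = y.1)
        (Finset.univ.filter fun p => (m p).1 = y'.1) := fun y _ y' _ hyy' =>
    Finset.disjoint_filter.2 fun p _ h h' => hyy' (Subtype.ext (h.symm.trans h'))
  rw [← Finset.card_biUnion hdisj]
  congr 1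
  ext p
  simp only [Finset.mem_biUnion, Finset.mem_filter_univ]
  refine ⟨fun ⟨y, hy, hpy⟩ => hpy.le.trans hy, fun hp => ?_⟩
  obtain ⟨-, -, hzx⟩ := (hB z.1).1 z.2
  exact ⟨⟨(m p).1, (hB _).2 ⟨(m p).2, ((hm p _).1 le_rfl).1, hp.trans hzx⟩⟩, hp, rfl⟩

variable [FaithfulSMul R K]
  (hcard : Fintype.card (arrangement K L).IntPoset ≤ Fintype.card (arrangement k L).IntPoset)

include hcard

theorem exists_isLeastFlatMap_univ :
    ∃ m, IsLeastFlatMap (K := K) (L := L) (k := k) Set.univ m := by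
  choose m hm using exists_forall_mem_reduction_iff_le hcard
  exact ⟨m, fun p x => by rw [← hm p x, and_iff_right (Set.mem_univ x)]⟩

theorem exists_isLeastFlatMap_Iic (y : (arrangement K L).IntPoset) :
    ∃ m, IsLeastFlatMap (k := k) (Set.Iic y) m := by
  choose m hm using exists_forall_mem_reduction_iff_le hcard
  choose n hn using fun p => Arrangement.exists_isGLB_pair y (m p)
  refine ⟨n, fun p x => ?_⟩
  rw [le_isGLB_iff (hn p), Set.mem_Iic, hm p x]
  simp [lowerBounds]

variable {D : Set (arrangement K L).IntPoset} {m : (Fin d → k) → (arrangement K L).IntPoset}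
  (hm : IsLeastFlatMap D m)

include hm

open Classical in
theorem card_filter_le_mul_pow_codim [Fintype k] {x : (arrangement K L).IntPoset} (hx : x ∈ D) :
    Finset.card {p | x ≤ m p} * Fintype.card k ^ (arrangement K L).codim x =
      Fintype.card k ^ d := by
  rw [← Nat.card_eq_fintype_card, ← natCard_reduction_mul_pow_codim hcard x,
    Nat.subtype_card (Finset.univ.filter fun p => x ≤ m p) fun p => by simp [hm p x, hx]]

open Classical in
theorem card_filter_eq_mul_pow_codim_of_isGreatest [Fintype k] {y : (arrangement K L).IntPoset}
    (hy : IsGreatest D y) :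
    Finset.card {p | m p = y} * Fintype.card k ^ (arrangement K L).codim y =
      Fintype.card k ^ d := by
  rw [← card_filter_le_mul_pow_codim hcard hm hy.1]
  congr 2
  ext p
  simp only [Finset.mem_filter_univ]
  exact ⟨fun h => h.ge, fun h => (hy.2 ((hm p _).1 le_rfl).1).antisymm h⟩

open Classical in
/-- The finite field method: for the arrangement `B` in `x` with flats `D ∩ [x, ·]`, the number of
points that lie on the reduction of `x` and of no larger flat in `D` is `q ^ dim x` times
`π_B (-q⁻¹)`. -/
theorem aeval_poincare_mul_pow [Fintype k] {x : (arrangement K L).IntPoset}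
    {B : Arrangement K (Fin d → K)} (hamb : B.ambient = x.1)
    (hB : ∀ w, B.IsFlat w ↔ ∃ h : (arrangement K L).IsFlat w, ⟨w, h⟩ ∈ D ∧ w ≤ x.1) :
    Polynomial.aeval (-(Fintype.card k : ℂ)⁻¹) B.poincare * (Fintype.card k : ℂ) ^ d =
      Finset.card {p | m p = x} * (Fintype.card k : ℂ) ^ (arrangement K L).codim x := by
  have hq : (Fintype.card k : ℂ) ≠ 0 := Nat.cast_ne_zero.2 Fintype.card_ne_zero
  let c : ℂ := (Fintype.card k : ℂ) ^ (arrangement K L).codim x / (Fintype.card k : ℂ) ^ d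
  let N (y : B.IntPoset) : ℂ := Finset.card {p | (m p).1 = y.1} * c
  have hN (z : B.IntPoset) :
      ∑ y with z ≤ y, N y = (Fintype.card k : ℂ)⁻¹ ^ B.codim z := by
    obtain ⟨hz, hzD, -⟩ := (hB z.1).1 z.2
    have hcount : Finset.card {p | (m p).1 ≤ z.1} *
        Fintype.card k ^ (arrangement K L).codim ⟨z.1, hz⟩ = Fintype.card k ^ d :=
      card_filter_le_mul_pow_codim hcard hm hzD
    rw [← Arrangement.codim_add_codim hamb] at hcount
    simp only [N, c]
    rw [← Finset.sum_mul, ← Nat.cast_sum, hm.sum_card_filter_eq hB z, mul_div_assoc',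
      div_eq_iff (pow_ne_zero d hq), ← Nat.cast_pow _ d, ← hcount, inv_pow]
    push_cast
    field_simp
    ring
  have hbot : N ⊥ = Finset.card {p | m p = x} * c := by
    have hx (p : Fin d → k) : m p = x ↔ (m p).1 = (⊥ : B.IntPoset).1 := by
      rw [show (⊥ : B.IntPoset).1 = x.1 from hamb]
      exact Subtype.ext_iff
    simp only [N, hx]
  rw [Arrangement.aeval_neg_poincare _ N hN, hbot, mul_assoc, div_mul_cancel₀ _ (pow_ne_zero _ hq)]

end ResidueClasses

end AffineForm

namespace AffineForm

section ScalingFactor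

variable {R : Type*} [CommRing R] {d : ℕ} {ι : Type*} [Fintype ι]
  {K : Type*} [Field K] [Algebra R K] {L : ι → AffineForm R d}
  {s : (arrangement K L).Nonbot → ℂ}

theorem pow_codim_mul_cpow_neg_gFun {q : ℂ} (hq : q ≠ 0) (x : (arrangement K L).Nonbot) :
    q ^ (arrangement K L).codim x.1 * q ^ (-(arrangement K L).gFun s x) =
      scalingFactor s q x.1 := by
  classical
  rw [← Complex.cpow_natCast, ← Complex.cpow_add _ _ hq, scalingFactor, Arrangement.gFun]
  simp [Arrangement.isFlat_sub_intPoset_iff]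

theorem norm_cpow_neg_gFun_lt_one {n : ℕ} (hn : 1 < n) (hs : s ∈ (arrangement K L).convDomain)
    (x : (arrangement K L).Nonbot) : ‖(n : ℂ) ^ (-(arrangement K L).gFun s x)‖ < 1 := by
  rw [Complex.norm_natCast_cpow_of_pos (zero_lt_one.trans hn), Complex.neg_re]
  exact Real.rpow_lt_one_of_one_lt_of_neg (mod_cast hn) (neg_neg_of_pos (hs x))

theorem cpow_neg_gFun_ne_one {n : ℕ} (hn : 1 < n) (hs : s ∈ (arrangement K L).convDomain)
    (x : (arrangement K L).Nonbot) : (n : ℂ) ^ (-(arrangement K L).gFun s x) ≠ 1 := fun h =>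
  (norm_cpow_neg_gFun_lt_one hn hs x).ne (h ▸ norm_one)

theorem enorm_scalingFactor_lt {n : ℕ} (hn : 1 < n) (hs : s ∈ (arrangement K L).convDomain)
    (x : (arrangement K L).Nonbot) :
    ‖scalingFactor s n x.1‖ₑ < (n : ENNReal) ^ (arrangement K L).codim x.1 := by
  have hn0 : 0 < n := zero_lt_one.trans hn
  have hnorm : ‖scalingFactor s n x.1‖ < (n ^ (arrangement K L).codim x.1 : ℕ) := by
    rw [← pow_codim_mul_cpow_neg_gFun (Nat.cast_ne_zero.2 hn0.ne'), norm_mul, norm_pow,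
      Complex.norm_natCast, Nat.cast_pow]
    exact mul_lt_of_lt_one_right (by positivity) (norm_cpow_neg_gFun_lt_one hn hs x)
  rw [← ofReal_norm, ← Nat.cast_pow]
  exact (ENNReal.ofReal_lt_natCast (pow_pos hn0 _).ne').2 hnorm

/-- `q⁻ᶜ κ ∫ f_x`, where `c` is the codimension of `x`, `f_x` the partial integrand of the flats
containing `x`, and `κ` its scaling factor. These are the unknowns of the linear system that the
sums over flags satisfy too. -/
def flatWeight (𝔬 : Type*) [CommRing 𝔬] [IsDomain 𝔬] [IsDiscreteValuationRing 𝔬] [Algebra R 𝔬]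
    [TopologicalSpace 𝔬] [IsTopologicalRing 𝔬] [CompactSpace 𝔬] [MeasurableSpace 𝔬]
    [BorelSpace 𝔬] (s : (arrangement K L).Nonbot → ℂ) (x : (arrangement K L).IntPoset) : ℂ :=
  ((residueCard 𝔬 : ℂ) ^ (arrangement K L).codim x)⁻¹ * scalingFactor s (residueCard 𝔬) x *
    ∫ z, partialIntegrand (Set.Iic x) s z ∂cubeHaar 𝔬 d

theorem flatWeight_nonbot {𝔬 : Type*} [CommRing 𝔬] [IsDomain 𝔬] [IsDiscreteValuationRing 𝔬]
    [Algebra R 𝔬] [TopologicalSpace 𝔬] [IsTopologicalRing 𝔬] [CompactSpace 𝔬] [MeasurableSpace 𝔬]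
    [BorelSpace 𝔬] (hq : (residueCard 𝔬 : ℂ) ≠ 0) (x : (arrangement K L).Nonbot) :
    flatWeight 𝔬 s x.1 = (residueCard 𝔬 : ℂ) ^ (-(arrangement K L).gFun s x) *
      ∫ z, partialIntegrand (Set.Iic x.1) s z ∂cubeHaar 𝔬 d := by
  rw [flatWeight, ← pow_codim_mul_cpow_neg_gFun hq, inv_mul_cancel_left₀ (pow_ne_zero _ hq)]

theorem flatWeight_bot {𝔬 : Type*} [CommRing 𝔬] [IsDomain 𝔬] [IsDiscreteValuationRing 𝔬]
    [Algebra R 𝔬] [TopologicalSpace 𝔬] [IsTopologicalRing 𝔬] [CompactSpace 𝔬] [MeasurableSpace 𝔬]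
    [BorelSpace 𝔬] [SecondCountableTopology 𝔬] : flatWeight 𝔬 s ⊥ = 1 := by
  classical
  have hscal : scalingFactor s (residueCard 𝔬) ⊥ = 1 := by
    rw [scalingFactor, Finset.filter_false_of_mem fun x _ hx => x.2 (le_bot_iff.1 hx)]
    simp
  simp [flatWeight, hscal, Arrangement.codim_bot, partialIntegrand_Iic_bot, -Set.Iic_bot]

end ScalingFactor

section Recursion

variable {R : Type*} [CommRing R] {d : ℕ} {ι : Type*} [Fintype ι]
  {K : Type*} [Field K] [Algebra R K] [FaithfulSMul R K] {L : ι → AffineForm R d}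
  {𝔬 : Type*} [CommRing 𝔬] [IsDomain 𝔬] [IsDiscreteValuationRing 𝔬] [Algebra R 𝔬]
  (hcard : Fintype.card (arrangement K L).IntPoset ≤
    Fintype.card (arrangement (ResidueField 𝔬) L).IntPoset)

include hcard

theorem exists_section_partialIntegrand_add_smul [Finite (ResidueField 𝔬)]
    {D : Set (arrangement K L).IntPoset}
    {m : (Fin d → ResidueField 𝔬) → (arrangement K L).IntPoset} (hm : IsLeastFlatMap D m)
    {ϖ : 𝔬} (hϖ : Irreducible ϖ) (s : (arrangement K L).Nonbot → ℂ) :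
    ∃ σ : (Fin d → ResidueField 𝔬) → Fin d → 𝔬, (∀ p j, residue 𝔬 (σ p j) = p j) ∧
      ∀ p z, partialIntegrand D s (σ p + ϖ • z) =
        scalingFactor s (residueCard 𝔬) (m p) *
          partialIntegrand (Set.Iic (m p)) s (σ p + z) := by
  choose σ hσ hσL using fun p => exists_lift_of_mem_reduction hcard ((hm p (m p)).1 le_rfl).2
  refine ⟨σ, hσ, fun p z => ?_⟩
  have hres : (fun j => residue 𝔬 ((σ p + ϖ • z) j)) = p := by
    funext j
    have h : residue 𝔬 ϖ = 0 := (residue_eq_zero_iff ϖ).2 hϖ.not_isUnit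
    simp [hσ p j, h]
  rw [partialIntegrand_eq_of_forall s (y := m p) fun x => by rw [hres, hm p x],
    partialIntegrand_Iic_add_smul s (hσL p) hϖ (zero_lt_one.trans (one_lt_residueCard 𝔬)).ne']

variable [TopologicalSpace 𝔬] [IsTopologicalRing 𝔬] [CompactSpace 𝔬] [MeasurableSpace 𝔬]
  [BorelSpace 𝔬] [SecondCountableTopology 𝔬] (hadic : IsAdic (maximalIdeal 𝔬))
  {s : (arrangement K L).Nonbot → ℂ}
  {D : Set (arrangement K L).IntPoset}
  {m : (Fin d → ResidueField 𝔬) → (arrangement K L).IntPoset} (hm : IsLeastFlatMap D m)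

include hadic hm

theorem integrable_partialIntegrand [Finite (ResidueField 𝔬)]
    (hint : ∀ p, Integrable (partialIntegrand (Set.Iic (m p)) s) (cubeHaar 𝔬 d)) :
    Integrable (partialIntegrand D s) (cubeHaar 𝔬 d) := by
  obtain ⟨ϖ, hϖ⟩ := IsDiscreteValuationRing.exists_irreducible 𝔬
  obtain ⟨σ, hσ, hσs⟩ := exists_section_partialIntegrand_add_smul hcard hm hϖ s
  refine integrable_cubeHaar_of_forall_add_smul hϖ.maximalIdeal_eq hσ
    (measurable_partialIntegrand s hadic D) fun p => ?_
  simp only [hσs]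
  exact ((hint p).comp_add_left (σ p)).const_mul _

theorem sum_scalingFactor_mul_integral [Fintype (ResidueField 𝔬)]
    (hint : ∀ p, Integrable (partialIntegrand (Set.Iic (m p)) s) (cubeHaar 𝔬 d)) :
    ∑ p, scalingFactor s (residueCard 𝔬) (m p) *
        ∫ z, partialIntegrand (Set.Iic (m p)) s z ∂cubeHaar 𝔬 d =
      (residueCard 𝔬 : ℂ) ^ d * ∫ z, partialIntegrand D s z ∂cubeHaar 𝔬 d := by
  obtain ⟨ϖ, hϖ⟩ := IsDiscreteValuationRing.exists_irreducible 𝔬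
  obtain ⟨σ, hσ, hσs⟩ := exists_section_partialIntegrand_add_smul hcard hm hϖ s
  rw [← sum_integral_add_smul hϖ.maximalIdeal_eq hσ (measurable_partialIntegrand s hadic D)]
  · simp only [hσs, integral_const_mul, integral_add_left_eq_self]
  · simp only [hσs]
    exact fun p => ((hint p).comp_add_left (σ p)).const_mul _

theorem sum_lintegral_min_enorm_partialIntegrand [Fintype (ResidueField 𝔬)] (b : ENNReal) :
    ∑ p, ∫⁻ z, min (‖scalingFactor s (residueCard 𝔬) (m p)‖ₑ *
        ‖partialIntegrand (Set.Iic (m p)) s z‖ₑ) b ∂cubeHaar 𝔬 d =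
      (residueCard 𝔬 : ENNReal) ^ d *
        ∫⁻ z, min ‖partialIntegrand D s z‖ₑ b ∂cubeHaar 𝔬 d := by
  obtain ⟨ϖ, hϖ⟩ := IsDiscreteValuationRing.exists_irreducible 𝔬
  obtain ⟨σ, hσ, hσs⟩ := exists_section_partialIntegrand_add_smul hcard hm hϖ s
  rw [← sum_lintegral_add_smul hϖ.maximalIdeal_eq hσ
    ((measurable_partialIntegrand s hadic D).enorm.min measurable_const)]
  refine Finset.sum_congr rfl fun p _ => ?_
  simp only [hσs, enorm_mul]
  exact (lintegral_add_left_eq_self (fun z => min (‖scalingFactor s (residueCard 𝔬) (m p)‖ₑ *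
    ‖partialIntegrand (Set.Iic (m p)) s z‖ₑ) b) (σ p)).symm

omit hadic hm [TopologicalSpace 𝔬] [IsTopologicalRing 𝔬] [CompactSpace 𝔬] [MeasurableSpace 𝔬]
  [BorelSpace 𝔬] [SecondCountableTopology 𝔬] in
open Classical in
theorem card_filter_eq_mul_max_enorm_scalingFactor_lt [Fintype (ResidueField 𝔬)]
    (hs : s ∈ (arrangement K L).convDomain) {y : (arrangement K L).Nonbot}
    (hm : IsLeastFlatMap (Set.Iic y.1) m) :
    (Finset.card {p | m p = y.1} : ℕ) * max ‖scalingFactor s (residueCard 𝔬) y.1‖ₑ 1 <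
      (residueCard 𝔬 : ENNReal) ^ d := by
  have hq := one_lt_residueCard 𝔬
  have hcount := card_filter_eq_mul_pow_codim_of_isGreatest hcard hm isGreatest_Iic
  rw [← Nat.card_eq_fintype_card] at hcount
  change _ * residueCard 𝔬 ^ _ = residueCard 𝔬 ^ d at hcount
  have hN : Finset.card {p | m p = y.1} ≠ 0 := left_ne_zero_of_mul
    (hcount.trans_ne (pow_ne_zero d (zero_lt_one.trans hq).ne'))
  have hcodim : (arrangement K L).codim y.1 ≠ 0 :=
    ((Nat.zero_le _).trans_lt ((arrangement K L).codim_strictMono (bot_lt_iff_ne_bot.2 y.2))).ne'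
  rw [← Nat.cast_pow, ← hcount, Nat.cast_mul, Nat.cast_pow]
  exact ENNReal.mul_lt_mul_right (Nat.cast_ne_zero.2 hN) (ENNReal.natCast_ne_top _)
    (max_lt (enorm_scalingFactor_lt hq hs y) (one_lt_pow₀ (by exact_mod_cast hq) hcodim))

omit hm in
theorem lintegral_enorm_partialIntegrand_Iic_ne_top [Finite (ResidueField 𝔬)]
    (hs : s ∈ (arrangement K L).convDomain) (y : (arrangement K L).Nonbot)
    (hlt : ∀ x < y.1, ∫⁻ z, ‖partialIntegrand (Set.Iic x) s z‖ₑ ∂cubeHaar 𝔬 d ≠ ⊤) :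
    ∫⁻ z, ‖partialIntegrand (Set.Iic y.1) s z‖ₑ ∂cubeHaar 𝔬 d ≠ ⊤ := by
  classical
  have := Fintype.ofFinite (ResidueField 𝔬)
  obtain ⟨m, hm⟩ := exists_isLeastFlatMap_Iic hcard y.1
  let f (x : (arrangement K L).IntPoset) (z : Fin d → 𝔬) := ‖partialIntegrand (Set.Iic x) s z‖ₑ
  let C (x : (arrangement K L).IntPoset) := ‖scalingFactor s (residueCard 𝔬) x‖ₑ
  have hf (x) : Measurable (f x) := (measurable_partialIntegrand s hadic _).enorm
  have hmy (p) : m p ≤ y.1 := ((hm p _).1 le_rfl).1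
  refine lintegral_ne_top_of_forall_lintegral_min_le (a := (residueCard 𝔬 : ENNReal) ^ d)
    (b := ∑ p with m p ≠ y.1, C (m p) * ∫⁻ z, f (m p) z ∂cubeHaar 𝔬 d)
    (c := (Finset.card {p | m p = y.1} : ℕ) * max (C y.1) 1) (hf y.1) ?_ ?_ fun n => ?_
  · refine ENNReal.sum_ne_top.2 fun p hp => ENNReal.mul_ne_top enorm_ne_top (hlt _ ?_)
    exact lt_of_le_of_ne (hmy p) (Finset.mem_filter.1 hp).2
  · exact card_filter_eq_mul_max_enorm_scalingFactor_lt hcard hs hm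
  · rw [← sum_lintegral_min_enorm_partialIntegrand hcard hadic hm,
      ← Finset.sum_filter_add_sum_filter_not _ fun p => m p = y.1, add_comm, mul_assoc,
      ← nsmul_eq_mul]
    refine add_le_add (Finset.sum_le_sum fun p _ => ?_)
      (Finset.sum_le_card_nsmul _ _ _ fun p hp => ?_)
    · rw [← lintegral_const_mul _ (hf _)]
      exact lintegral_mono fun z => min_le_left _ _
    · rw [← lintegral_const_mul _ ((hf _).min measurable_const), (Finset.mem_filter.1 hp).2]
      refine lintegral_mono fun z => ?_
      rw [mul_min]
      exact min_le_min (mul_le_mul_left (le_max_left _ _) _)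
        (le_mul_of_one_le_left' (le_max_right _ _))

omit hm in
theorem integrable_partialIntegrand_Iic [Finite (ResidueField 𝔬)]
    (hs : s ∈ (arrangement K L).convDomain) (y : (arrangement K L).IntPoset) :
    Integrable (partialIntegrand (Set.Iic y) s) (cubeHaar 𝔬 d) := by
  suffices h : ∫⁻ z, ‖partialIntegrand (Set.Iic y) s z‖ₑ ∂cubeHaar 𝔬 d ≠ ⊤ from
    ⟨(measurable_partialIntegrand s hadic _).aestronglyMeasurable, h.lt_top⟩
  induction y using WellFoundedLT.induction with
  | ind y ih =>
    by_cases hy : y = ⊥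
    · rw [hy]
      simp [-Set.Iic_bot, partialIntegrand_Iic_bot]
    · exact lintegral_enorm_partialIntegrand_Iic_ne_top hcard hadic hs ⟨y, hy⟩ ih

open Classical in
theorem integral_partialIntegrand_eq_sum_flatWeight [Finite (ResidueField 𝔬)]
    (hs : s ∈ (arrangement K L).convDomain)
    {B : (arrangement K L).IntPoset → Arrangement K (Fin d → K)}
    (hamb : ∀ x ∈ D, (B x).ambient = x.1) (hB : ∀ x ∈ D, ∀ w, (B x).IsFlat w ↔
      ∃ h : (arrangement K L).IsFlat w, ⟨w, h⟩ ∈ D ∧ w ≤ x.1) :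
    ∫ z, partialIntegrand D s z ∂cubeHaar 𝔬 d =
      ∑ x with x ∈ D, Polynomial.aeval (-(residueCard 𝔬 : ℂ)⁻¹) (B x).poincare *
        flatWeight 𝔬 s x := by
  have := Fintype.ofFinite (ResidueField 𝔬)
  have hq : residueCard 𝔬 = Fintype.card (ResidueField 𝔬) := Nat.card_eq_fintype_card
  have hq0 : (residueCard 𝔬 : ℂ) ≠ 0 :=
    Nat.cast_ne_zero.2 (zero_lt_one.trans (one_lt_residueCard 𝔬)).ne'
  let κ := scalingFactor s (residueCard 𝔬)
  let Z (x : (arrangement K L).IntPoset) := ∫ z, partialIntegrand (Set.Iic x) s z ∂cubeHaar 𝔬 d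
  have hint := integrable_partialIntegrand_Iic hcard hadic hs
  refine mul_left_cancel₀ (pow_ne_zero d hq0) ?_
  calc (residueCard 𝔬 : ℂ) ^ d * ∫ z, partialIntegrand D s z ∂cubeHaar 𝔬 d
      = ∑ p, κ (m p) * Z (m p) :=
        (sum_scalingFactor_mul_integral hcard hadic hm fun p => hint (m p)).symm
    _ = ∑ x with x ∈ D, Finset.card {p | m p = x} * (κ x * Z x) := by
        rw [← Finset.sum_fiberwise_of_maps_to (g := m) (t := {x | x ∈ D})
          fun p _ => Finset.mem_filter_univ _ |>.2 ((hm p _).1 le_rfl).1]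
        refine Finset.sum_congr rfl fun x _ => ?_
        rw [Finset.sum_congr rfl fun p hp => by rw [(Finset.mem_filter.1 hp).2], Finset.sum_const,
          nsmul_eq_mul]
    _ = _ := by
        rw [Finset.mul_sum]
        refine Finset.sum_congr rfl fun x hx => ?_
        have hxD := (Finset.mem_filter.1 hx).2
        have hcount := aeval_poincare_mul_pow hcard hm (hamb x hxD) (hB x hxD)
        rw [← hq] at hcount
        rw [eq_div_of_mul_eq (pow_ne_zero _ hq0) hcount.symm]
        simp only [flatWeight, κ, Z]
        ring

open Classical in
omit hm in
theorem flatWeight_eq_mul_sum [Finite (ResidueField 𝔬)]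
    (hs : s ∈ (arrangement K L).convDomain) (y : (arrangement K L).Nonbot) :
    flatWeight 𝔬 s y.1 =
      (residueCard 𝔬 : ℂ) ^ (-(arrangement K L).gFun s y) /
          (1 - (residueCard 𝔬 : ℂ) ^ (-(arrangement K L).gFun s y)) *
        ∑ x with x < y.1, Polynomial.aeval (-(residueCard 𝔬 : ℂ)⁻¹)
          (((arrangement K L).restrict x).sub y.1.1).poincare * flatWeight 𝔬 s x := by
  have hq := one_lt_residueCard 𝔬
  have hq0 : (residueCard 𝔬 : ℂ) ≠ 0 := Nat.cast_ne_zero.2 (zero_lt_one.trans hq).ne'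
  obtain ⟨m, hm⟩ := exists_isLeastFlatMap_Iic hcard y.1
  have hZ := integral_partialIntegrand_eq_sum_flatWeight hcard hadic hm hs
    (B := fun x => ((arrangement K L).restrict x).sub y.1.1) (fun x _ => rfl) fun x hx w => by
      rw [Arrangement.isFlat_sub_restrict_iff hx]
      exact ⟨fun ⟨h, hwx, hyw⟩ => ⟨h, hyw, hwx⟩, fun ⟨h, hyw, hwx⟩ => ⟨h, hwx, hyw⟩⟩
  replace hZ := hZ.trans <| Finset.sum_congr
    (show _ = insert y.1 ({x | x < y.1} : Finset (arrangement K L).IntPoset) by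
      ext x; simp [le_iff_eq_or_lt]) fun _ _ => rfl
  rw [Finset.sum_insert (by simp), Arrangement.poincare_sub_restrict_self,
    map_one, one_mul] at hZ
  have hW := flatWeight_nonbot (𝔬 := 𝔬) (s := s) hq0 y
  rw [hZ] at hW
  have hT := cpow_neg_gFun_ne_one hq hs y
  rw [div_mul_eq_mul_div, eq_div_iff (sub_ne_zero.2 hT.symm)]
  linear_combination hW

omit hm in
theorem analyticZeta_eq_fHP [Finite (ResidueField 𝔬)] (hs : s ∈ (arrangement K L).convDomain) :
    analyticZeta K L 𝔬 s = (arrangement K L).fHP (-(residueCard 𝔬 : ℂ)⁻¹)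
      (fun x => (residueCard 𝔬 : ℂ) ^ (-(arrangement K L).gFun s x)) := by
  classical
  obtain ⟨m, hm⟩ := exists_isLeastFlatMap_univ hcard
  rw [analyticZeta, ← partialIntegrand_univ,
    integral_partialIntegrand_eq_sum_flatWeight hcard hadic hm hs
      (B := (arrangement K L).restrict) (fun x _ => rfl)
      fun x _ w => by
        rw [Arrangement.isFlat_restrict_iff]
        exact ⟨fun ⟨h, hw⟩ => ⟨h, trivial, hw⟩, fun ⟨h, _, hw⟩ => ⟨h, hw⟩⟩,
    Arrangement.fHP_eq_flagSum, ← Arrangement.sum_aeval_poincare_mul_eq_flagSum _ flatWeight_bot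
      (flatWeight_eq_mul_sum hcard hadic hs)]
  simp

omit hm in
theorem integrable_zetaIntegrand [Finite (ResidueField 𝔬)]
    (hs : s ∈ (arrangement K L).convDomain) :
    Integrable (zetaIntegrand K L s) (cubeHaar 𝔬 d) := by
  obtain ⟨m, hm⟩ := exists_isLeastFlatMap_univ hcard
  rw [← partialIntegrand_univ]
  exact integrable_partialIntegrand hcard hadic hm fun p =>
    integrable_partialIntegrand_Iic hcard hadic hs (m p)

end Recursion

end AffineForm

theorem analyticAt_list_prod {𝕜 E B α : Type*} [NontriviallyNormedField 𝕜] [NormedAddCommGroup E]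
    [NormedSpace 𝕜 E] [NormedRing B] [NormedAlgebra 𝕜 B] {f : α → E → B} {e : E} (l : List α)
    (h : ∀ a ∈ l, AnalyticAt 𝕜 (f a) e) :
    AnalyticAt 𝕜 (fun e => (l.map fun a => f a e).prod) e := by
  induction l with
  | nil => exact analyticAt_const
  | cons a l ih =>
    simp only [List.map_cons, List.prod_cons]
    exact (h a List.mem_cons_self).mul (ih fun b hb => h b (List.mem_cons_of_mem a hb))

theorem countable_setOf_cpow_neg_eq_one {q : ℂ} (hlog : Complex.log q ≠ 0) :
    {z : ℂ | q ^ (-z) = 1}.Countable := by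
  have hq : q ≠ 0 := fun h => hlog (by rw [h, Complex.log_zero])
  refine (Set.countable_range fun n : ℤ =>
    -(n * (2 * Real.pi * Complex.I)) / Complex.log q).mono fun z (hz : q ^ (-z) = 1) => ?_
  rw [Complex.cpow_def_of_ne_zero hq, Complex.exp_eq_one_iff] at hz
  obtain ⟨n, hn⟩ := hz
  exact ⟨n, by simp only [← hn]; field_simp⟩

theorem isConnected_setOf_cpow_neg_ne_one {q : ℂ} (hlog : Complex.log q ≠ 0) :
    IsConnected {z : ℂ | q ^ (-z) ≠ 1} :=
  ((countable_setOf_cpow_neg_eq_one hlog).isPathConnected_compl_of_one_lt_rank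
    (by simp [Complex.rank_real_complex])).isConnected

namespace Arrangement

section Continuation

variable {k V : Type*} [Field k] [AddCommGroup V] [Module k V] (A : Arrangement k V) {q : ℂ}

theorem analyticAt_gFun (x : A.Nonbot) (s : A.Nonbot → ℂ) :
    AnalyticAt ℂ (fun s => A.gFun s x) s := by
  unfold gFun
  refine analyticAt_const.add (Finset.analyticAt_fun_sum _ fun y _ => ?_)
  exact (ContinuousLinearMap.proj (R := ℂ) (φ := fun _ : A.Nonbot => ℂ) y).analyticAt s

theorem continuous_gFun (x : A.Nonbot) : Continuous fun s => A.gFun s x :=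
  continuous_iff_continuousAt.2 fun s => (A.analyticAt_gFun x s).continuousAt

theorem continuous_hFun : Continuous A.hFun := by
  unfold hFun
  fun_prop

theorem analyticAt_cpow_neg_gFun (hq : q ≠ 0) (x : A.Nonbot) (s : A.Nonbot → ℂ) :
    AnalyticAt ℂ (fun s => q ^ (-A.gFun s x)) s := by
  simp_rw [Complex.cpow_def_of_ne_zero hq]
  exact (analyticAt_const.mul (A.analyticAt_gFun x s).neg).cexp

theorem isOpen_convDomain : IsOpen A.convDomain := by
  simp only [convDomain, Set.ofPred_forall]
  exact isOpen_iInter_of_finite fun x =>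
    isOpen_lt continuous_const (Complex.continuous_re.comp (A.continuous_gFun x))

theorem isOpen_regularDomain (hq : q ≠ 0) : IsOpen (A.regularDomain q) := by
  simp only [regularDomain, Set.ofPred_forall]
  exact isOpen_iInter_of_finite fun x => isOpen_ne_fun (continuous_iff_continuousAt.2
    fun s => (A.analyticAt_cpow_neg_gFun hq x s).continuousAt) continuous_const

theorem hFun_mem_convDomain {r : A.Nonbot → ℂ} (hr : ∀ x, 0 < (r x).re) :
    A.hFun r ∈ A.convDomain := fun x => by
  rw [gFun_hFun]
  exact hr x

theorem hFun_mem_regularDomain {r : A.Nonbot → ℂ} (hr : ∀ x, q ^ (-r x) ≠ 1) :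
    A.hFun r ∈ A.regularDomain q := fun x => by
  rw [gFun_hFun]
  exact hr x

theorem convDomain_nonempty : A.convDomain.Nonempty :=
  ⟨A.hFun 1, A.hFun_mem_convDomain fun _ => by simp⟩

theorem isConnected_regularDomain (hlog : Complex.log q ≠ 0) :
    IsConnected (A.regularDomain q) := by
  have himage : A.hFun '' Set.univ.pi (fun _ => {z : ℂ | q ^ (-z) ≠ 1}) = A.regularDomain q := by
    refine Set.Subset.antisymm (Set.image_subset_iff.2 fun r hr => ?_) fun s hs => ?_
    · exact A.hFun_mem_regularDomain fun x => hr x trivial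
    · exact ⟨A.gFun s, fun x _ => hs x, A.hFun_gFun s⟩
  rw [← himage]
  exact (isConnected_univ_pi.2 fun _ => isConnected_setOf_cpow_neg_ne_one hlog).image _
    A.continuous_hFun.continuousOn

theorem analyticOnNhd_fHP [FiniteDimensional k V] (hq : q ≠ 0) (Y : ℂ) :
    AnalyticOnNhd ℂ (fun s => A.fHP Y fun x => q ^ (-A.gFun s x)) (A.regularDomain q) := by
  refine fun s hs => Finset.analyticAt_fun_sum _ fun F _ => analyticAt_const.mul ?_
  refine analyticAt_list_prod F.1 fun x _ => ?_
  exact (A.analyticAt_cpow_neg_gFun hq x s).div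
    (analyticAt_const.sub (A.analyticAt_cpow_neg_gFun hq x s)) (sub_ne_zero.2 (hs x).symm)

end Continuation

end Arrangement

namespace AffineForm

theorem zeroLocus_mem_members {R k : Type*} [CommRing R] [Field k] [Algebra R k] {d : ℕ}
    {ι : Type*} [Fintype ι] {L : ι → AffineForm R d} {i : ι} (hi : (L i).IsNonconstant k) :
    (L i).zeroLocus k ∈ (arrangement k L).members := by
  classical
  exact Finset.mem_image_of_mem _ (Finset.mem_filter.2 ⟨Finset.mem_univ i, hi⟩)

section ZetaFunction

variable {R : Type*} [CommRing R] {d : ℕ} {ι : Type*} [Fintype ι]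
  {K : Type*} [Field K] [Algebra R K] [FaithfulSMul R K] {L : ι → AffineForm R d}
  {𝔬 : Type*} [CommRing 𝔬] [IsDomain 𝔬] [IsDiscreteValuationRing 𝔬]
  [TopologicalSpace 𝔬] [IsTopologicalRing 𝔬] [CompactSpace 𝔬]
  [MeasurableSpace 𝔬] [BorelSpace 𝔬] [SecondCountableTopology 𝔬] [Finite (ResidueField 𝔬)]
  [Algebra R 𝔬] (hadic : IsAdic (maximalIdeal 𝔬))
  (hcard : Fintype.card (arrangement K L).IntPoset ≤
    Fintype.card (arrangement (ResidueField 𝔬) L).IntPoset)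

include hadic hcard

theorem isAnalyticContinuation_analyticZeta :
    IsAnalyticContinuation (analyticZeta K L 𝔬) (arrangement K L).convDomain
      (fun s => (arrangement K L).fHP (-(residueCard 𝔬 : ℂ)⁻¹)
        fun x => (residueCard 𝔬 : ℂ) ^ (-(arrangement K L).gFun s x))
      ((arrangement K L).regularDomain (residueCard 𝔬)) := by
  have hq := one_lt_residueCard 𝔬
  have hq0 : (residueCard 𝔬 : ℂ) ≠ 0 := Nat.cast_ne_zero.2 (zero_lt_one.trans hq).ne'
  have hlog : Complex.log (residueCard 𝔬) ≠ 0 := by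
    rw [← Complex.natCast_log]
    exact_mod_cast (Real.log_pos (by exact_mod_cast hq)).ne'
  exact {
    isOpen_left := Arrangement.isOpen_convDomain _
    nonempty := Arrangement.convDomain_nonempty _
    isOpen := Arrangement.isOpen_regularDomain _ hq0
    isConnected := Arrangement.isConnected_regularDomain _ hlog
    subset := fun s hs x => cpow_neg_gFun_ne_one hq hs x
    analytic := Arrangement.analyticOnNhd_fHP _ hq0 _
    eqOn := fun s hs => (analyticZeta_eq_fHP hcard hadic hs).symm }

open Classical in
theorem analyticZeta_eq_of_isCentral (hcentral : (arrangement K L).IsCentral)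
    (hne : (arrangement K L).members.Nonempty) {s : (arrangement K L).Nonbot → ℂ}
    (hs : s ∈ (arrangement K L).convDomain) :
    analyticZeta K L 𝔬 s =
      1 / (1 - (residueCard 𝔬 : ℂ) ^ (-((arrangement K L).rank : ℂ) - ∑ y, s y)) *
        ∑ F : (arrangement K L).Flag with ∀ x ∈ F.1, ¬ IsTop x.1,
          Polynomial.aeval (-(residueCard 𝔬 : ℂ)⁻¹) ((arrangement K L).flagPoincare F) *
            (F.1.map fun x => (residueCard 𝔬 : ℂ) ^ (-(arrangement K L).gFun s x) /
              (1 - (residueCard 𝔬 : ℂ) ^ (-(arrangement K L).gFun s x))).prod := by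
  obtain ⟨t, ht⟩ := hcentral.exists_isTop
  let t' : (arrangement K L).Nonbot := ⟨t, Arrangement.ne_bot_of_isTop ht hne⟩
  have ht' : IsTop t'.1 := ht
  rw [analyticZeta_eq_fHP hcard hadic hs, Arrangement.fHP_eq_of_isTop _ _ ht'
    (cpow_neg_gFun_ne_one (one_lt_residueCard 𝔬) hs t'), Arrangement.gFun_of_isTop _ ht', neg_add']

end ZetaFunction

end AffineForm

end

open AffineForm in
theorem theoremB_general {R K : Type*} [CommRing R] [Field K] [Algebra R K] [FaithfulSMul R K]
    {d : ℕ} {ι : Type*} [Fintype ι] (L : ι → AffineForm R d)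
    {𝔬 : Type*} [CommRing 𝔬] [IsDomain 𝔬] [IsDiscreteValuationRing 𝔬]
    [TopologicalSpace 𝔬] [IsTopologicalRing 𝔬] [CompactSpace 𝔬]
    [MeasurableSpace 𝔬] [BorelSpace 𝔬] (hadic : IsAdic (maximalIdeal 𝔬)) [Algebra R 𝔬]
    (hcard : Fintype.card (arrangement K L).IntPoset ≤
      Fintype.card (arrangement (ResidueField 𝔬) L).IntPoset)
    (q : ℂ) (hq : q = residueCard 𝔬) :
    (∀ s ∈ (arrangement K L).convDomain,
      Integrable (zetaIntegrand K L s) (cubeHaar 𝔬 d) ∧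
      analyticZeta K L 𝔬 s = (arrangement K L).fHP (-q⁻¹)
        (fun x => q ^ (-(arrangement K L).gFun s x))) ∧
    (∀ r : (arrangement K L).Nonbot → ℂ, (∀ x, 0 < (r x).re) →
      Integrable (zetaIntegrand K L ((arrangement K L).hFun r)) (cubeHaar 𝔬 d) ∧
      (arrangement K L).fHP (-q⁻¹) (fun x => q ^ (-r x)) =
        analyticZeta K L 𝔬 ((arrangement K L).hFun r)) ∧
    (∃ Z : ((arrangement K L).Nonbot → ℂ) → ℂ,
      IsAnalyticContinuation (analyticZeta K L 𝔬) (arrangement K L).convDomain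
        Z ((arrangement K L).regularDomain q) ∧
      (∀ s ∈ (arrangement K L).regularDomain q,
        Z s = (arrangement K L).fHP (-q⁻¹)
          (fun x => q ^ (-(arrangement K L).gFun s x))) ∧
      (∀ r : (arrangement K L).Nonbot → ℂ, (∀ x, q ^ (-r x) ≠ 1) →
        (arrangement K L).hFun r ∈ (arrangement K L).regularDomain q ∧
        (arrangement K L).fHP (-q⁻¹) (fun x => q ^ (-r x)) =
          Z ((arrangement K L).hFun r))) ∧
    (∀ s ∈ (arrangement K L).convDomain, analyticZeta K L 𝔬 s =
      ∑ F : (arrangement K L).Flag,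
        Polynomial.aeval (-q⁻¹) ((arrangement K L).flagPoincare F) *
        (F.1.map fun x => q ^ (-(arrangement K L).gFun s x) /
          (1 - q ^ (-(arrangement K L).gFun s x))).prod) ∧
    ((arrangement K L).IsCentral → (arrangement K L).members.Nonempty →
      ∀ s ∈ (arrangement K L).convDomain, analyticZeta K L 𝔬 s =
        1 / (1 - q ^ (-((arrangement K L).rank : ℂ) - ∑ y, s y)) *
        open Classical in
        ∑ F : (arrangement K L).Flag with ∀ x ∈ F.1, ¬ IsTop x.1,
          Polynomial.aeval (-q⁻¹) ((arrangement K L).flagPoincare F) *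
          (F.1.map fun x => q ^ (-(arrangement K L).gFun s x) /
            (1 - q ^ (-(arrangement K L).gFun s x))).prod) := by
  subst hq
  have := secondCountableTopology_of_isAdic hadic
  have := finite_residueField_of_isAdic hadic
  have hzeta (s) (hs : s ∈ (arrangement K L).convDomain) :=
    And.intro (integrable_zetaIntegrand hcard hadic hs) (analyticZeta_eq_fHP hcard hadic hs)
  refine ⟨hzeta, fun r hr => ?_, ⟨_, isAnalyticContinuation_analyticZeta hadic hcard,
    fun s _ => rfl, fun r hr => ⟨Arrangement.hFun_mem_regularDomain _ hr, ?_⟩⟩,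
    fun s hs => (hzeta s hs).2,
    fun hcentral hne s hs => analyticZeta_eq_of_isCentral hadic hcard hcentral hne hs⟩
  · obtain ⟨hint, heq⟩ := hzeta _ (Arrangement.hFun_mem_convDomain _ hr)
    rw [Arrangement.gFun_hFun] at heq
    exact ⟨hint, heq.symm⟩
  · simp only [Arrangement.gFun_hFun]

theorem theoremB {K : Type*} [Field K] [NumberField K] {d : ℕ} {ι : Type*} [Fintype ι]
    (L : ι → AffineForm (NumberField.RingOfIntegers K) d)
    (hL : ∀ i, (L i).IsNonconstant K)
    (hinj : Function.Injective fun i => (L i).zeroLocus K)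
    {𝔬 : Type*} [CommRing 𝔬] [IsDomain 𝔬] [IsDiscreteValuationRing 𝔬]
    [TopologicalSpace 𝔬] [IsTopologicalRing 𝔬] [CompactSpace 𝔬]
    [MeasurableSpace 𝔬] [BorelSpace 𝔬] (hadic : IsAdic (IsLocalRing.maximalIdeal 𝔬))
    [Algebra (NumberField.RingOfIntegers K) 𝔬]
    (hgood : HasGoodReduction K L 𝔬)
    (q : ℂ) (hq : q = residueCard 𝔬) :
    -- the zeta function as a value of the flag Hilbert–Poincaré series
    (∀ s ∈ (AffineForm.arrangement K L).convDomain,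
      Integrable (zetaIntegrand K L s) (cubeHaar 𝔬 d) ∧
      analyticZeta K L 𝔬 s = (AffineForm.arrangement K L).fHP (-q⁻¹)
        (fun x => q ^ (-(AffineForm.arrangement K L).gFun s x))) ∧
    -- the flag Hilbert–Poincaré series as a value of the zeta function
    (∀ r : (AffineForm.arrangement K L).Nonbot → ℂ, (∀ x, 0 < (r x).re) →
      Integrable (zetaIntegrand K L ((AffineForm.arrangement K L).hFun r)) (cubeHaar 𝔬 d) ∧
      (AffineForm.arrangement K L).fHP (-q⁻¹) (fun x => q ^ (-r x)) =
        analyticZeta K L 𝔬 ((AffineForm.arrangement K L).hFun r)) ∧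
    -- both identities for the analytic continuation
    (∃ Z : ((AffineForm.arrangement K L).Nonbot → ℂ) → ℂ,
      IsAnalyticContinuation (analyticZeta K L 𝔬) (AffineForm.arrangement K L).convDomain
        Z ((AffineForm.arrangement K L).regularDomain q) ∧
      (∀ s ∈ (AffineForm.arrangement K L).regularDomain q,
        Z s = (AffineForm.arrangement K L).fHP (-q⁻¹)
          (fun x => q ^ (-(AffineForm.arrangement K L).gFun s x))) ∧
      (∀ r : (AffineForm.arrangement K L).Nonbot → ℂ, (∀ x, q ^ (-r x) ≠ 1) →
        (AffineForm.arrangement K L).hFun r ∈ (AffineForm.arrangement K L).regularDomain q ∧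
        (AffineForm.arrangement K L).fHP (-q⁻¹) (fun x => q ^ (-r x)) =
          Z ((AffineForm.arrangement K L).hFun r))) ∧
    -- the explicit sum over flags
    (∀ s ∈ (AffineForm.arrangement K L).convDomain, analyticZeta K L 𝔬 s =
      ∑ F : (AffineForm.arrangement K L).Flag,
        Polynomial.aeval (-q⁻¹) ((AffineForm.arrangement K L).flagPoincare F) *
        (F.1.map fun x => q ^ (-(AffineForm.arrangement K L).gFun s x) /
          (1 - q ^ (-(AffineForm.arrangement K L).gFun s x))).prod) ∧
    -- the explicit sum over flags avoiding the top element, for central arrangements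
    ((AffineForm.arrangement K L).IsCentral → Nonempty ι →
      ∀ s ∈ (AffineForm.arrangement K L).convDomain, analyticZeta K L 𝔬 s =
        1 / (1 - q ^ (-((AffineForm.arrangement K L).rank : ℂ) - ∑ y, s y)) *
        open Classical in
        ∑ F : (AffineForm.arrangement K L).Flag with ∀ x ∈ F.1, ¬ IsTop x.1,
          Polynomial.aeval (-q⁻¹) ((AffineForm.arrangement K L).flagPoincare F) *
          (F.1.map fun x => q ^ (-(AffineForm.arrangement K L).gFun s x) /
            (1 - q ^ (-(AffineForm.arrangement K L).gFun s x))).prod) := by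
  obtain ⟨e⟩ := hgood
  obtain ⟨h₁, h₂, h₃, h₄, h₅⟩ :=
    theoremB_general L hadic (Fintype.card_congr e.toEquiv).le q hq
  exact ⟨h₁, h₂, h₃, h₄, fun hcentral ⟨i⟩ =>
    h₅ hcentral ⟨_, AffineForm.zeroLocus_mem_members (hL i)⟩⟩
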